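/- **Setting.** An instance of the (unrooted) repairman problem consists of a connected graph with $N$ nodes and nonnegative edge lengths (travel distance = length of a shortest path) and $n_0\ge 1$ service requests, each located at a node and having a time window $[w,w+L)$. A service run of speed $v$ services some of the requests, each at a time in its window, so that between any two serviced requests there is enough time to travel at speed $v$ from one to the other; its profit is the number of requests serviced. Unit speed is $v=1$. The input size is $n=N+n_0$. The periods of length $\alpha$ with starting point $\tau$ are $[\tau+z\alpha,\tau+(z+1)\alpha)$, $z\in\mathbb Z$. A window is in $W_\ell$ (for these periods) if it completely fills exactly $\ell$ periods and partially overlaps two more. Trimming replaces a window by one of the periods it completely fills, or drops it. The graph property $\gamma\ge 1$ and the function $\Gamma(n)\ge n$ of a class of graphs are the approximation ratio and the running time of an algorithm TRIM for the repairman problem on trimmed windows: on every graph of the class and for every speed $v$ it finds, in at most $\Gamma(n)$ steps, a run of speed $v$ on the trimmed windows whose profit is at least $1/\gamma$ times that of any run of speed $v$ on the trimmed windows. SPEEDUP (speed $s$, period length $\alpha$, nominal starting point $b$, given trimming choice) works with the following sets of periods. If the end points of windows have more than $r$ different residues modulo $\alpha$, it takes the $r$ starting points $b+j\alpha/r$,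 $0\le j<r$; otherwise it takes one starting point at each of these residues. Each starting point is moved forward by half the distance to the next end point of a window modulo $\alpha$, so that no window starts or ends on a period boundary. For each set of periods it trims the windows and runs TRIM at speed $s$. SPEEDUPW12 calls SPEEDUP with - $\alpha=\frac12$, $b=\frac i4$ ($i=0,1$), trimming windows in $W_1,W_2,W_3$ to their first, $j$-th, $k$-th completely filled period, for $j=1,2$ and $k=1,2,3$; - $\alpha=\frac34$, $b=\frac i4$ ($i=0,1,2$), trimming windows in $W_1,W_2$ to their first, $j$-th completely filled period, for $j=1,2$; - $\alpha=1$, $b=\frac i4$ ($i=0,1,2,3$), trimming windows in $W_1$ to their completely filled period; all other windows are dropped, and the most profitable run found is returned. Let $m$ be the number of essentially different sets of periods of length $\frac12$, i.e. the number of different residues modulo $\frac12$ of end points of windows. Steps are counted on a real random access machine, a call of TRIM counting with its own number of steps. **Theorem.** There is an absolute constant $C$ such that the following holds for every class of graphs with $\gamma,\Gamma$ as above. Let $2\le s\le \frac52$, and either $s=q/r$ with integers $q\ge 0$, $r\ge1$, or $r=\infty$ ($s$ any real number). Let an instance on a graph of the class be given such that, for $i=0$ or for $i=1$, all windows are in $W_2$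 for each of the sets of periods that SPEEDUP tries for $\alpha=\frac12$ and $b=\frac i4$. Then SPEEDUPW12 finds a service run $\hat R$ of speed $s$ for the instance with $$\mathrm{profit}(R)\le \frac{8\gamma}{2s-1}\,\mathrm{profit}(\hat R)\quad\text{for every service run } R \text{ of unit speed},$$ i.e. an $8\gamma/(2s-1)$-approximation, in at most $C\min\{r,m\}\,\Gamma(n)$ steps. -/

import Mathlib

namespace Repairman

/-! ### Computations with a step count -/

/-- The result of a computation together with the number of elementary steps it has taken.
Arithmetic on real numbers (including rounding down), comparisons, and reading or writing one
entry of a list or table are elementary steps (real random access machine). -/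
structure Timed (β : Type) where
  val : β
  steps : ℕ

namespace Timed

instance : Monad Timed where
  pure b := ⟨b, 0⟩
  bind x f := ⟨(f x.val).val, x.steps + (f x.val).steps⟩

/-- Spend `k` elementary steps. -/
def tick (k : ℕ) : Timed Unit := ⟨(), k⟩

/-- Apply a procedure to every entry of a list. -/
def mapList {β δ : Type} (f : β → Timed δ) (l : List β) : Timed (List δ) :=
  ⟨l.map fun b => (f b).val, (l.map fun b => (f b).steps + 1).sum⟩

/-- Fill a table with `n` entries by a procedure. -/
def tabulate {n : ℕ} {β : Type} (f : Fin n → Timed β) : Timed (Fin n → β) :=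
  ⟨fun e => (f e).val, ∑ e, ((f e).steps + 1)⟩

end Timed

/-! ### Graphs, instances, service runs -/

/-- A connected graph on `N` nodes whose edges carry nonnegative lengths. -/
structure WeightedGraph (N : ℕ) where
  graph : SimpleGraph (Fin N)
  connected : graph.Connected
  length : Sym2 (Fin N) → ℝ
  length_nonneg : ∀ e ∈ graph.edgeSet, 0 ≤ length e

/-- Travel distance: the least total length of a walk. -/
noncomputable def WeightedGraph.dist {N : ℕ} (G : WeightedGraph N) (u v : Fin N) : ℝ :=
  ⨅ p : G.graph.Walk u v, (p.edges.map G.length).sum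

/-- A class of weighted graphs (trees, all graphs, ...). -/
abbrev GraphClass := ∀ N : ℕ, WeightedGraph N → Prop

/-- An instance of the (unrooted) repairman problem: `n` service requests, the request `e` being
located at the node `loc e` and valid in the time window `[start e, start e + len e)`. -/
structure Instance (N n : ℕ) where
  graph : WeightedGraph N
  loc : Fin n → Fin N
  start : Fin n → ℝ
  len : Fin n → ℝ

/-- A service run: the requests it services, with the times at which it services them
(`time e` is irrelevant when `e` is not serviced). -/
structure Run (n : ℕ) where
  served : Finset (Fin n)
  time : Fin n → ℝ

/-- The profit of a run is the number of requests serviced. -/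
def Run.profit {n : ℕ} (R : Run n) : ℕ := R.served.card

/-- The run that services nothing. -/
def Run.empty (n : ℕ) : Run n := ⟨∅, fun _ => 0⟩

/-- A repairman of speed `v` can carry out the run `R`: between any two serviced requests there is
enough time to travel from one to the other. (By the triangle inequality it would be the same to
ask this of consecutive requests only. The run may start anywhere at any time.) -/
def Run.Travels {N n : ℕ} (G : WeightedGraph N) (loc : Fin n → Fin N) (v : ℝ) (R : Run n) : Prop :=
  ∀ e ∈ R.served, ∀ f ∈ R.served, G.dist (loc e) (loc f) ≤ v * |R.time e - R.time f|

/-- `R` is a service run of the instance at speed `v`: every request it counts is serviced during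
its time window. -/
def Instance.IsRun {N n : ℕ} (I : Instance N n) (v : ℝ) (R : Run n) : Prop :=
  R.Travels I.graph I.loc v ∧
    ∀ e ∈ R.served, R.time e ∈ Set.Ico (I.start e) (I.start e + I.len e)

/-! ### Periods and trimming

The periods of length `α` with starting point `τ` are `[τ + z α, τ + (z + 1) α)`, `z ∈ ℤ`. -/

/-- The window `[w, w + L)` belongs to `W_ℓ`: it completely fills exactly `ℓ` periods (those with
numbers `z, …, z + ℓ - 1`) and partially overlaps two more (numbers `z - 1` and `z + ℓ`). -/
def InW (ℓ : ℕ) (α τ w L : ℝ) : Prop :=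
  ∃ z : ℤ, τ + (z - 1) * α < w ∧ w < τ + z * α ∧
    τ + (z + ℓ) * α < w + L ∧ w + L < τ + (z + ℓ + 1) * α

/-- A trimmed instance: periods of length `α` with starting point `τ`, and for every request either
the number of the one period its window has been trimmed to, or `none` if the window has vanished
(such a request cannot be serviced). -/
structure TrimmedInstance (N n : ℕ) where
  graph : WeightedGraph N
  loc : Fin n → Fin N
  α : ℝ
  τ : ℝ
  period : Fin n → Option ℤ

/-- `R` is a service run of the trimmed instance at speed `v`. -/
def TrimmedInstance.IsRun {N n : ℕ} (T : TrimmedInstance N n) (v : ℝ) (R : Run n) : Prop :=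
  R.Travels T.graph T.loc v ∧
    ∀ e ∈ R.served, ∃ z : ℤ, T.period e = some z ∧
      R.time e ∈ Set.Ico (T.τ + z * T.α) (T.τ + (z + 1) * T.α)

/-- A trimming scheme: `c ℓ = some j` if windows in `W_ℓ` are trimmed to their `j`-th completely
filled period, `c ℓ = none` if they are dropped. -/
abbrev Scheme := ℕ → Option ℕ

/-- Trim the window `[w, w + L)`: the first completely filled period has number `z`, and there are
`ℓ` of them. -/
noncomputable def trimWindow (α τ : ℝ) (c : Scheme) (w L : ℝ) : Option ℤ :=
  let z : ℤ := ⌊(w - τ) / α⌋ + 1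
  let ℓ : ℤ := ⌊(w + L - τ) / α⌋ - z
  (c ℓ.toNat).map fun j => z + j - 1

/-- Trim all windows, at a constant number of steps per window. -/
noncomputable def trim {N n : ℕ} (I : Instance N n) (α τ : ℝ) (c : Scheme) :
    Timed (TrimmedInstance N n) := do
  let p ← Timed.tabulate fun e => do
    Timed.tick 1
    pure (trimWindow α τ c (I.start e) (I.len e))
  pure ⟨I.graph, I.loc, α, τ, p⟩

/-- A procedure for the repairman problem on trimmed windows; the second argument is the speed. -/
abbrev TrimmedAlg := ∀ {N n : ℕ}, TrimmedInstance N n → ℝ → Timed (Run n)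

/-- `alg` is a `γ`-approximation algorithm with running time `Γ` for the repairman problem on
trimmed windows on graphs of the class `𝒢`: at every speed `v` it finds a run of speed `v` whose
profit is at least `1 / γ` times that of every run of speed `v`, in at most `Γ (N + n)` steps if
there are `N` nodes and `n` requests. -/
def IsTrimmedApprox (𝒢 : GraphClass) (γ : ℝ) (Γ : ℕ → ℕ) (alg : TrimmedAlg) : Prop :=
  ∀ (N n : ℕ) (T : TrimmedInstance N n) (v : ℝ), 𝒢 N T.graph → 0 < T.α → 0 < v →
    T.IsRun v (alg T v).val ∧
    (∀ R : Run n, T.IsRun v R → (R.profit : ℝ) ≤ γ * (alg T v).val.profit) ∧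
    (alg T v).steps ≤ Γ (N + n)

/-! ### The sets of periods that are tried

Moving the starting point of the periods changes the set of periods completely filled by some
window (up to a common translation in time) only when a period boundary passes an end point of a
window. So there are as many essentially different sets of periods of length `α` as there are
different end points of windows modulo `α`. -/

/-- The representative of `x` modulo `α` in `[0, α)`. -/
noncomputable def residue (α x : ℝ) : ℝ := α * Int.fract (x / α)

/-- The number `m` of different sets of periods, for periods of length `1/2`. -/
noncomputable def numPeriodSets {N n : ℕ} (I : Instance N n) : ℕ :=
  (Set.range (fun e => residue (1 / 2) (I.start e)) ∪
    Set.range (fun e => residue (1 / 2) (I.start e + I.len e))).ncard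

/-- List the end points of all windows. -/
noncomputable def endpoints {N n : ℕ} (I : Instance N n) : Timed (List ℝ) :=
  ⟨(List.finRange n).flatMap fun e => [I.start e, I.start e + I.len e], 2 * n⟩

/-- The least positive residue modulo `α` of `x - b` over all `x` in a list (`α` if none). -/
noncomputable def leastGap (α b : ℝ) : List ℝ → Timed ℝ
  | [] => pure α
  | x :: xs => do
    let g ← leastGap α b xs
    Timed.tick 1
    let d := residue α (x - b)
    pure (if 0 < d ∧ d < g then d else g)

/-- Move the starting point `b` halfway to the next end point modulo `α`, so that no window starts
or ends on a period boundary. -/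
noncomputable def nudge (α : ℝ) (xs : List ℝ) (b : ℝ) : Timed ℝ := do
  let g ← leastGap α b xs
  Timed.tick 1
  pure (b + g / 2)

open Classical in
/-- Search for a number in a list. -/
noncomputable def search (d : ℝ) : List ℝ → Timed Bool
  | [] => pure false
  | x :: xs => do
    Timed.tick 1
    if d = x then pure true else search d xs

/-- Collect the different residues modulo `α` of a list of numbers, but give up (`none`) as soon
as there are more than `r` of them. -/
noncomputable def distinctResidues (α : ℝ) (r : ℕ∞) : List ℝ → List ℝ → Timed (Option (List ℝ))
  | [], acc => pure (some acc)
  | x :: xs, acc => do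
    Timed.tick 1
    let d := residue α x
    let seen ← search d acc
    if seen then distinctResidues α r xs acc
    else if (acc.length : ℕ∞) < r then distinctResidues α r xs (d :: acc)
    else pure none

/-- The starting points that are tried for periods of length `α` with nominal starting point `b`.
If there are more than `r` different sets of periods, these are the `r` equally spaced points
`b + j α / r`, `0 ≤ j < r`; otherwise one starting point for every different set of periods. All of
them are moved off the end points of the windows. -/
noncomputable def startingPoints (α b : ℝ) (r : ℕ∞) {N n : ℕ} (I : Instance N n) :
    Timed (List ℝ) := do
  let xs ← endpoints I
  let found ← distinctResidues α r xs []
  let bs ← match found with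
    | some ρ => pure ρ
    | none => Timed.mapList (fun j : ℕ => (do
        Timed.tick 1
        pure (b + j * α / (r.toNat : ℝ)) : Timed ℝ)) (List.range r.toNat)
  Timed.mapList (nudge α xs) bs

/-! ### SPEEDUP and SPEEDUPW12 -/

/-- The more profitable of two runs. -/
def better {n : ℕ} (R Q : Run n) : Timed (Run n) :=
  ⟨if R.profit < Q.profit then Q else R, 2 * n + 1⟩

/-- Carry out a procedure for every entry of a list and retain the most profitable run found. -/
def retainBest {n : ℕ} {ι : Type} (f : ι → Timed (Run n)) : List ι → Run n → Timed (Run n)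
  | [], best => pure best
  | x :: xs, best => do
    let R ← f x
    let best ← better best R
    retainBest f xs best

/-- SPEEDUP, with periods of length `α`, nominal starting point `b` and trimming scheme `c`: for
every set of periods that is tried, trim the windows and run `alg` at speed `s`. -/
noncomputable def speedup (alg : TrimmedAlg) (s : ℝ) (r : ℕ∞) {N n : ℕ} (I : Instance N n)
    (α b : ℝ) (c : Scheme) : Timed (Run n) := do
  let τs ← startingPoints α b r I
  retainBest (fun τ => do
    let T ← trim I α τ c
    alg T s) τs (Run.empty n)

/-- The parameters of one call of SPEEDUP. -/
structure Call where
  α : ℝ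
  b : ℝ
  c : Scheme

/-- Trim windows in `W_1` to their first completely filled period. -/
def scheme1 : Scheme
  | 1 => some 1
  | _ => none

/-- Moreover trim windows in `W_2` to their `j`-th completely filled period. -/
def scheme2 (j : ℕ) : Scheme
  | 1 => some 1
  | 2 => some j
  | _ => none

/-- Moreover trim windows in `W_3` to their `k`-th completely filled period. -/
def scheme3 (j k : ℕ) : Scheme
  | 1 => some 1
  | 2 => some j
  | 3 => some k
  | _ => none

noncomputable def phase1 : List Call :=
  [0, 1].flatMap fun i : ℕ => [1, 2].flatMap fun j : ℕ => [1, 2, 3].map fun k : ℕ =>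
    ⟨1 / 2, i / 4, scheme3 j k⟩

noncomputable def phase2 : List Call :=
  [0, 1, 2].flatMap fun i : ℕ => [1, 2].map fun j : ℕ => ⟨3 / 4, i / 4, scheme2 j⟩

noncomputable def phase3 : List Call :=
  [0, 1, 2, 3].map fun i : ℕ => ⟨1, i / 4, scheme1⟩

/-- SPEEDUPW12 at speedup `s`. The parameter `r` is the denominator in `s = q / r`, or `⊤` if no
such representation is used. -/
noncomputable def speedupW12 (alg : TrimmedAlg) (s : ℝ) (r : ℕ∞) {N n : ℕ} (I : Instance N n) :
    Timed (Run n) :=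
  retainBest (fun call => speedup alg s r I call.α call.b call.c)
    (phase1 ++ phase2 ++ phase3) (Run.empty n)

end Repairman

/-! Let `s = q/r` and cut time into cells of length `1/(2r)`. A period of length `1/2` has `r`
cells, and in one period a repairman of speed `s` can retrace `q` cells of the unit-speed run `R`.
All windows are in W_2 and are trimmed to their first filled period, so in period `z` the fast
repairman may service exactly the requests whose windows begin to fill at `z`. Counted from the
start of that period, `R` services such a request in a cell `k` with `-r ≤ k < 3r`.

The fast repairman moves along the trajectory of `R`. In every other period it sweeps forward over
`q` cells; in between it covers `q - r` cells by moving back and forth and ends where the next sweep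
begins. Four positions of this pattern, each with either parity of the sweeping periods, give eight
runs. With weights 3, 3, 1, 1 on the positions, the total weight is 16, so if `B` bounds the profit
of every run on the trimmed windows, the weighted number of visits to requests is at most `16 * B`
(`sum_coverWeight_le`).

Now average over the `r` grid positions of the period boundaries. For a fixed request, `k` runs
through `r` consecutive values, over which the cover weights sum to at least `4q - 2r`
(`sum_coverWeight`). Double counting (`profit_le_of_grid`) yields `(4q - 2r) * profit R ≤ 16 * r *
B`. Since `B` is `γ` times the profit found, the ratio is `8γ/(2s - 1)`.

The algorithm need not try the grid positions themselves: `exists_startingPoint` matches each of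
them with a tried starting point that separates the window end points in the same way. For real `s`
with `r = ⊤` all grids are available, and `s` is approximated by rationals from below. The calls
with other parameters matter only for validity and running time. -/

namespace Repairman

/-! ### Covering counts on the grid of cells -/

open Finset in
/-- The number of elements of `[a, b)` in a window of at most its length. -/
theorem sum_Ico_indicator (M r a b : ℤ) (h : a + r ≤ b) :
    ∃ x, ∑ k ∈ Ico (M - r) M, (if a ≤ k ∧ k < b then (1 : ℤ) else 0) = x ∧
      0 ≤ x ∧ (r ≤ x ∨ M - a ≤ x ∧ M < a + r ∨ b - M + r ≤ x ∧ b < M) := by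
  have h : (Ico (M - r) M).filter (fun k => a ≤ k ∧ k < b) = Ico (max (M - r) a) (min M b) := by
    ext k; simp only [mem_filter, mem_Ico]; omega
  rw [Finset.sum_ite, h]
  simp [Int.card_Ico]
  omega

/-- The total weight, over the eight kinds of periods, of those in which cell `k` is visited. -/
def coverWeight (r q k : ℤ) : ℤ :=
  3 * ((if -r ≤ k ∧ k < q - r then 1 else 0) + (if -r ≤ k ∧ k < q - 2 * r then 1 else 0)) +
  3 * ((if 3 * r - q ≤ k ∧ k < 3 * r then 1 else 0) +
    (if 4 * r - q ≤ k ∧ k < 3 * r then 1 else 0)) +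
  ((if 4 * r - 2 * q ≤ k ∧ k < 4 * r - q then 1 else 0) +
    (if 4 * r - 2 * q ≤ k ∧ k < 3 * r - q then 1 else 0)) +
  ((if q - 2 * r ≤ k ∧ k < 2 * q - 2 * r then 1 else 0) +
    (if q - r ≤ k ∧ k < 2 * q - 2 * r then 1 else 0))

/-- The overlap of `[M - r, M)` with each interval is piecewise linear in `M`. At `M = 0` there is
equality: the intervals starting at `-r` give `6r`, those starting at `4r - 2q` give `2(2q - 4r)`.
The latter needs `4r - 2q ≥ -r`, which is `h2`; `h1` makes all eight intervals at least `r` long. -/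
theorem sum_coverWeight (r q M : ℤ) (h1 : 2 * r ≤ q) (h2 : 2 * q ≤ 5 * r)
    (hM0 : 0 ≤ M) (hM : M ≤ 3 * r) :
    4 * q - 2 * r ≤ ∑ k ∈ Finset.Ico (M - r) M, coverWeight r q k := by
  simp only [coverWeight, Finset.sum_add_distrib, ← Finset.mul_sum]
  obtain ⟨x1, e1, g1⟩ := sum_Ico_indicator M r (-r) (q - r) (by omega)
  obtain ⟨x2, e2, g2⟩ := sum_Ico_indicator M r (-r) (q - 2 * r) (by omega)
  obtain ⟨x3, e3, g3⟩ := sum_Ico_indicator M r (3 * r - q) (3 * r) (by omega)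
  obtain ⟨x4, e4, g4⟩ := sum_Ico_indicator M r (4 * r - q) (3 * r) (by omega)
  obtain ⟨x5, e5, g5⟩ := sum_Ico_indicator M r (4 * r - 2 * q) (4 * r - q) (by omega)
  obtain ⟨x6, e6, g6⟩ := sum_Ico_indicator M r (4 * r - 2 * q) (3 * r - q) (by omega)
  obtain ⟨x7, e7, g7⟩ := sum_Ico_indicator M r (q - 2 * r) (2 * q - 2 * r) (by omega)
  obtain ⟨x8, e8, g8⟩ := sum_Ico_indicator M r (q - r) (2 * q - 2 * r) (by omega)
  rw [e1, e2, e3, e4, e5, e6, e7, e8]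
  clear e1 e2 e3 e4 e5 e6 e7 e8
  rcases le_total M r with h | h
  · omega
  rcases le_total M (2 * r) with h' | h'
  · omega
  · omega

/-! ### Fast runs that retrace a unit-speed run -/

/-- A function on the line glued from Lipschitz functions on consecutive intervals of length `P`
is Lipschitz. -/
theorem abs_sub_le_of_glued {P s : ℝ} (hP : 0 ≤ P) (ψ : ℤ → ℝ → ℝ)
    (hlip : ∀ z, ∀ θ ∈ Set.Icc 0 P, ∀ θ' ∈ Set.Icc 0 P, |ψ z θ - ψ z θ'| ≤ s * |θ - θ'|)
    (hglue : ∀ z, ψ z P = ψ (z + 1) 0) (z z' : ℤ) {θ θ' : ℝ}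
    (hθ : θ ∈ Set.Icc 0 P) (hθ' : θ' ∈ Set.Icc 0 P) :
    |ψ z θ - ψ z' θ'| ≤ s * |(P * z + θ) - (P * z' + θ')| := by
  have h0 : (0 : ℝ) ∈ Set.Icc 0 P := ⟨le_rfl, hP⟩
  have h1 : P ∈ Set.Icc 0 P := ⟨hP, le_rfl⟩
  -- Here `n` is the number of whole pieces strictly between the two points.
  have key : ∀ (n : ℕ) (z : ℤ), ∀ θ ∈ Set.Icc 0 P, ∀ θ' ∈ Set.Icc 0 P,
      |ψ z θ - ψ (z + (n + 1 : ℕ)) θ'| ≤ s * (P - θ + n * P + θ') := by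
    intro n
    induction n with
    | zero =>
      intro z θ hθ θ' hθ'
      have a := hlip z θ hθ P h1
      have b := hlip (z + 1) 0 h0 θ' hθ'
      rw [abs_of_nonpos (by linarith [hθ.2] : θ - P ≤ 0), hglue] at a
      rw [abs_of_nonpos (by linarith [hθ'.1] : 0 - θ' ≤ 0)] at b
      have := abs_sub_le (ψ z θ) (ψ (z + 1) 0) (ψ (z + 1) θ')
      rw [zero_add, Nat.cast_one, Nat.cast_zero]
      linarith
    | succ n ih =>
      intro z θ hθ θ' hθ'
      have a := ih z θ hθ P h1
      have b := hlip (z + (n + 1 : ℕ) + 1) 0 h0 θ' hθ'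
      rw [hglue] at a
      rw [abs_of_nonpos (by linarith [hθ'.1] : 0 - θ' ≤ 0)] at b
      have e : z + ((n + 1 + 1 : ℕ) : ℤ) = z + (n + 1 : ℕ) + 1 := by push_cast; ring
      rw [e]
      have := abs_sub_le (ψ z θ) (ψ (z + (n + 1 : ℕ) + 1) 0) (ψ (z + (n + 1 : ℕ) + 1) θ')
      push_cast at *
      linarith
  have main : ∀ z z' : ℤ, z < z' → ∀ θ ∈ Set.Icc 0 P, ∀ θ' ∈ Set.Icc 0 P,
      |ψ z θ - ψ z' θ'| ≤ s * |(P * z + θ) - (P * z' + θ')| := by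
    intro z z' hz θ hθ θ' hθ'
    obtain ⟨n, rfl⟩ : ∃ n : ℕ, z' = z + (n + 1 : ℕ) := ⟨(z' - z - 1).toNat, by omega⟩
    refine (key n z θ hθ θ' hθ').trans (le_of_eq ?_)
    have : 0 ≤ (n : ℝ) * P := by positivity
    push_cast
    rw [abs_of_nonpos (by linarith [hθ.2, hθ'.1])]
    ring
  rcases lt_trichotomy z z' with h | rfl | h
  · exact main z z' h θ hθ θ' hθ'
  · have := hlip z θ hθ θ' hθ'
    rwa [add_sub_add_left_eq_sub]
  · rw [abs_sub_comm, abs_sub_comm (P * z + θ)]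
    exact main z' z h θ' hθ' θ hθ

open Classical in
/-- If every run of speed `s` servicing requests `e` in the `z e`-th interval has profit at
most `B`, this bounds the number of requests that `R` services at times the `z e`-th piece of a
glued Lipschitz function passes through. -/
theorem card_le_of_glued {N n : ℕ} {G : WeightedGraph N} {loc : Fin n → Fin N} {R : Run n}
    (hR : R.Travels G loc 1) {h P s : ℝ} (hh : 0 < h) (hP : 0 ≤ P) (c d : ℝ) (z : Fin n → ℤ)
    (ψ : ℤ → ℝ → ℝ)
    (hlip : ∀ z, ∀ θ ∈ Set.Icc 0 P, ∀ θ' ∈ Set.Icc 0 P, |ψ z θ - ψ z θ'| ≤ s * |θ - θ'|)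
    (hglue : ∀ z, ψ z P = ψ (z + 1) 0) {B : ℝ}
    (hB : ∀ Q : Run n, Q.served ⊆ R.served → Q.Travels G loc s →
      (∀ e ∈ Q.served, Q.time e ∈ Set.Ico (d + h * (P * z e)) (d + h * (P * (z e + 1)))) →
      (Q.profit : ℝ) ≤ B) :
    ((R.served.filter fun e => ∃ θ ∈ Set.Ico 0 P, c + h * ψ (z e) θ = R.time e).card : ℝ) ≤ B := by
  have hex : ∀ e, ∃ θ, e ∈ R.served.filter
      (fun e => ∃ θ ∈ Set.Ico 0 P, c + h * ψ (z e) θ = R.time e) →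
      θ ∈ Set.Ico 0 P ∧ c + h * ψ (z e) θ = R.time e := by
    intro e
    by_cases he : e ∈ R.served.filter
      (fun e => ∃ θ ∈ Set.Ico 0 P, c + h * ψ (z e) θ = R.time e)
    · obtain ⟨θ, h1, h2⟩ := (Finset.mem_filter.1 he).2
      exact ⟨θ, fun _ => ⟨h1, h2⟩⟩
    · exact ⟨0, fun h => absurd h he⟩
  choose θ hθ using hex
  -- The new run is where `R` is at the time given by `ψ`. The origin `d` of its periods may differ
  -- from the origin `c` used for `R`; only time differences matter.
  refine hB ⟨_, fun e => d + h * (P * z e + θ e)⟩ (Finset.filter_subset _ _) ?_ ?_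
  · intro e he f hf
    obtain ⟨a1, a2⟩ := hθ e he
    obtain ⟨b1, b2⟩ := hθ f hf
    refine (hR e (Finset.mem_filter.1 he).1 f (Finset.mem_filter.1 hf).1).trans ?_
    have := abs_sub_le_of_glued hP ψ hlip hglue (z e) (z f) ⟨a1.1, a1.2.le⟩ ⟨b1.1, b1.2.le⟩
    rw [← a2, ← b2, one_mul]
    have e1 : c + h * ψ (z e) (θ e) - (c + h * ψ (z f) (θ f)) =
        h * (ψ (z e) (θ e) - ψ (z f) (θ f)) := by ring
    have e2 : d + h * (P * z e + θ e) - (d + h * (P * z f + θ f)) =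
        h * ((P * z e + θ e) - (P * z f + θ f)) := by ring
    simp only [e1, e2, abs_mul, abs_of_pos hh]
    nlinarith
  · intro e he
    obtain ⟨a1, a2⟩ := hθ e he
    constructor <;> simp only <;> nlinarith [a1.1, a1.2]

open Classical in
/-- Alternating between two kinds `fA`, `fB` of pieces. -/
theorem card_add_card_le {N n : ℕ} {G : WeightedGraph N} {loc : Fin n → Fin N} {R : Run n}
    (hR : R.Travels G loc 1) {h P s : ℝ} (hh : 0 < h) (hP : 0 ≤ P) (c d : ℝ) (z : Fin n → ℤ)
    (fA fB : ℝ → ℝ)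
    (hA : ∀ θ θ', |fA θ - fA θ'| ≤ s * |θ - θ'|)
    (hfB : ∀ θ θ', |fB θ - fB θ'| ≤ s * |θ - θ'|)
    (hAB : fA P = P + fB 0) (hBA : fB P = P + fA 0) {B : ℝ}
    (hB : ∀ Q : Run n, Q.served ⊆ R.served → Q.Travels G loc s →
      (∀ e ∈ Q.served, Q.time e ∈ Set.Ico (d + h * (P * z e)) (d + h * (P * (z e + 1)))) →
      (Q.profit : ℝ) ≤ B) :
    ((R.served.filter fun e => ∃ θ ∈ Set.Ico 0 P, c + h * (P * z e + fA θ) = R.time e).card : ℝ) +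
    (R.served.filter fun e => ∃ θ ∈ Set.Ico 0 P, c + h * (P * z e + fB θ) = R.time e).card
      ≤ 2 * B := by
  have one : ∀ f g : ℝ → ℝ, (∀ θ θ', |f θ - f θ'| ≤ s * |θ - θ'|) →
      (∀ θ θ', |g θ - g θ'| ≤ s * |θ - θ'|) → f P = P + g 0 → g P = P + f 0 →
      ((R.served.filter fun e => ∃ θ ∈ Set.Ico 0 P,
        c + h * (P * z e + if Even (z e) then f θ else g θ) = R.time e).card : ℝ) ≤ B := by
    intro f g hf hg hfg hgf
    refine card_le_of_glued hR hh hP c d z (fun z θ => P * z + if Even z then f θ else g θ)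
      ?_ ?_ hB
    · intro z θ _ θ' _
      simp only [add_sub_add_left_eq_sub]
      split_ifs
      · exact hf _ _
      · exact hg _ _
    · intro z
      by_cases hz : Even z
      · have : ¬ Even (z + 1) := by simpa [Int.even_add_one] using hz
        simp only [hz, this, if_true, if_false, hfg]; push_cast; ring
      · have : Even (z + 1) := by simpa [Int.even_add_one] using hz
        simp only [hz, this, if_true, if_false, hgf]; push_cast; ring
  have h1 := one fA fB hA hfB hAB hBA
  have h2 := one fB fA hfB hA hBA hAB
  -- The two parities together expose every request once to `fA` and once to `fB`.
  have : ((R.served.filter fun e => ∃ θ ∈ Set.Ico 0 P,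
      c + h * (P * z e + fA θ) = R.time e).card : ℝ) +
    (R.served.filter fun e => ∃ θ ∈ Set.Ico 0 P, c + h * (P * z e + fB θ) = R.time e).card =
    (R.served.filter fun e => ∃ θ ∈ Set.Ico 0 P,
        c + h * (P * z e + if Even (z e) then fA θ else fB θ) = R.time e).card +
    (R.served.filter fun e => ∃ θ ∈ Set.Ico 0 P,
        c + h * (P * z e + if Even (z e) then fB θ else fA θ) = R.time e).card := by
    simp only [Finset.card_filter]
    push_cast
    rw [← Finset.sum_add_distrib, ← Finset.sum_add_distrib]
    refine Finset.sum_congr rfl fun e _ => ?_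
    by_cases hz : Even (z e)
    · simp only [hz, if_true]
    · simp only [hz, if_false]; rw [add_comm]
  linarith

/-- Service times can be moved off a grid. -/
theorem Instance.IsRun.exists_off_grid {N n : ℕ} {I : Instance N n} {v : ℝ} {R : Run n}
    (hR : I.IsRun v R) (b h : ℝ) (hh : 0 < h) :
    ∃ R' : Run n, R'.served = R.served ∧ I.IsRun v R' ∧
      ∀ e ∈ R.served, ∀ l : ℤ, R'.time e ≠ b + h * l := by
  have ev : ∀ e ∈ R.served, ∀ᶠ ε in nhdsWithin (0 : ℝ) (Set.Ioi 0),
      R.time e + ε < I.start e + I.len e ∧ ∀ l : ℤ, R.time e + ε ≠ b + h * l := by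
    intro e he
    have h1 := (hR.2 e he).2
    have h2 := Int.lt_floor_add_one ((R.time e - b) / h)
    rw [div_lt_iff₀ hh] at h2
    have h3 := Int.floor_le ((R.time e - b) / h)
    rw [le_div_iff₀ hh] at h3
    set m := ⌊(R.time e - b) / h⌋
    -- A common delay smaller than the time left in each window and the time to the next grid line
    -- works for all requests.
    have hpos : 0 < min (I.start e + I.len e - R.time e) (b + h * (m + 1) - R.time e) :=
      lt_min (by linarith) (by linarith)
    filter_upwards [Ioo_mem_nhdsGT hpos] with ε hε
    obtain ⟨h4, h5⟩ := lt_min_iff.1 hε.2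
    refine ⟨by linarith, fun l hl => ?_⟩
    have a1 : (m : ℝ) < l := by
      by_contra hc
      have := mul_le_mul_of_nonneg_left (not_lt.1 hc) hh.le
      linarith [hε.1]
    have a2 : (l : ℝ) < m + 1 := by
      by_contra hc
      have := mul_le_mul_of_nonneg_left (not_lt.1 hc) hh.le
      linarith
    have a3 : m < l := by exact_mod_cast a1
    have a4 : l < m + 1 := by exact_mod_cast a2
    omega
  have ev' : ∀ᶠ ε in nhdsWithin (0 : ℝ) (Set.Ioi 0), ∀ e ∈ R.served,
      R.time e + ε < I.start e + I.len e ∧ ∀ l : ℤ, R.time e + ε ≠ b + h * l :=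
    (Filter.eventually_all_finset _).2 ev
  obtain ⟨ε, hε, hpos⟩ := (ev'.and self_mem_nhdsWithin).exists
  refine ⟨⟨R.served, fun e => R.time e + ε⟩, rfl, ⟨fun e he f hf => ?_, fun e he => ?_⟩,
    fun e he => (hε e he).2⟩
  · have := hR.1 e he f hf
    simpa using this
  · exact ⟨(hR.2 e he).1.trans (by simpa using (Set.mem_Ioi.1 hpos).le), (hε e he).1⟩

/-! ### Tours measured in cells -/

theorem abs_sub_abs_le_mul {s c : ℝ} (hs : 0 ≤ s) (θ θ' : ℝ) :
    |(|s * θ - c| - |s * θ' - c|)| ≤ s * |θ - θ'| := by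
  refine (abs_abs_sub_abs_le _ _).trans (le_of_eq ?_)
  rw [sub_sub_sub_cancel_right, ← mul_sub, abs_mul, abs_of_nonneg hs]

theorem abs_sub_eq_mul {s lo : ℝ} (hs : 0 ≤ s) (θ θ' : ℝ) :
    |(lo + s * θ) - (lo + s * θ')| ≤ s * |θ - θ'| := by
  rw [add_sub_add_left_eq_sub, ← mul_sub, abs_mul, abs_of_nonneg hs]

section Cells

variable {N n : ℕ} {G : WeightedGraph N} {loc : Fin n → Fin N} {R : Run n} {h s : ℝ} {r q : ℤ}
  {c d B : ℝ} {z k : Fin n → ℤ}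

-- Service times lie strictly inside their cells, so a tour need only pass through the interior
-- points of a range of cells. This is why `cA` and `cB` leave out the ends, which a tour may reach
-- only at the excluded time `θ = r`.
open Classical in
theorem sum_cells_le_of_tour (hR : R.Travels G loc 1) (hh : 0 < h) (hr : 0 < r)
    (fA fB : ℝ → ℝ) (a b a' b' : ℤ)
    (hA : ∀ θ θ', |fA θ - fA θ'| ≤ s * |θ - θ'|)
    (hfB : ∀ θ θ', |fB θ - fB θ'| ≤ s * |θ - θ'|)
    (hAB : fA r = r + fB 0) (hBA : fB r = r + fA 0)
    (hk : ∀ e ∈ R.served, c + h * (r * z e + k e) < R.time e ∧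
      R.time e < c + h * (r * z e + (k e + 1)))
    (hB : ∀ Q : Run n, Q.served ⊆ R.served → Q.Travels G loc s →
      (∀ e ∈ Q.served, Q.time e ∈ Set.Ico (d + h * (r * z e)) (d + h * (r * (z e + 1)))) →
      (Q.profit : ℝ) ≤ B)
    (cA : ∀ y : ℝ, (a : ℝ) < y → y < b → ∃ θ ∈ Set.Ico (0 : ℝ) r, fA θ = y)
    (cB : ∀ y : ℝ, (a' : ℝ) < y → y < b' → ∃ θ ∈ Set.Ico (0 : ℝ) r, fB θ = y) :
    ((∑ e ∈ R.served, ((if a ≤ k e ∧ k e < b then 1 else 0) +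
      (if a' ≤ k e ∧ k e < b' then 1 else 0)) : ℤ) : ℝ) ≤ 2 * B := by
  have hr' : (0 : ℝ) ≤ r := by exact_mod_cast hr.le
  refine le_trans ?_ (card_add_card_le hR hh hr' c d z fA fB hA hfB hAB hBA hB)
  have aux : ∀ (f : ℝ → ℝ) (a b : ℤ),
      (∀ y : ℝ, (a : ℝ) < y → y < b → ∃ θ ∈ Set.Ico (0 : ℝ) r, f θ = y) →
      (R.served.filter fun e => a ≤ k e ∧ k e < b).card ≤
      (R.served.filter fun e => ∃ θ ∈ Set.Ico (0 : ℝ) r,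
        c + h * (r * z e + f θ) = R.time e).card := by
    intro f a b hf
    refine Finset.card_le_card fun e he => ?_
    rw [Finset.mem_filter] at he ⊢
    obtain ⟨he, h1, h2⟩ := he
    obtain ⟨h3, h4⟩ := hk e he
    have h1' : (a : ℝ) ≤ k e := by exact_mod_cast h1
    have h2' : (k e : ℝ) + 1 ≤ b := by exact_mod_cast h2
    have h5 : (r * z e + k e : ℝ) < (R.time e - c) / h := by rw [lt_div_iff₀ hh]; linarith
    have h6 : (R.time e - c) / h < r * z e + (k e + 1) := by rw [div_lt_iff₀ hh]; linarith
    obtain ⟨θ, hθ, hy⟩ := hf ((R.time e - c) / h - r * z e) (by linarith) (by linarith)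
    refine ⟨he, θ, hθ, ?_⟩
    rw [hy]
    field_simp
    ring
  have e1 := aux fA a b cA
  have e2 := aux fB a' b' cB
  have : (∑ e ∈ R.served, ((if a ≤ k e ∧ k e < b then 1 else 0) +
      (if a' ≤ k e ∧ k e < b' then 1 else 0)) : ℤ) =
      (R.served.filter fun e => a ≤ k e ∧ k e < b).card +
      (R.served.filter fun e => a' ≤ k e ∧ k e < b').card := by
    simp [Finset.sum_add_distrib]
  rw [this]
  push_cast
  exact_mod_cast add_le_add e1 e2

/-- In every other period the run goes forward; in between it goes back and forward again. -/
theorem sum_cells_le (hR : R.Travels G loc 1) (hh : 0 < h) (hr : 0 < r) (hrq : r < q)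
    (hs : s * r = q) (lo b b' : ℤ) (hb : b = lo + q) (hb' : b' = lo + q - r)
    (hk : ∀ e ∈ R.served, c + h * (r * z e + k e) < R.time e ∧
      R.time e < c + h * (r * z e + (k e + 1)))
    (hB : ∀ Q : Run n, Q.served ⊆ R.served → Q.Travels G loc s →
      (∀ e ∈ Q.served, Q.time e ∈ Set.Ico (d + h * (r * z e)) (d + h * (r * (z e + 1)))) →
      (Q.profit : ℝ) ≤ B) :
    ((∑ e ∈ R.served, ((if lo ≤ k e ∧ k e < b then 1 else 0) +
      (if lo ≤ k e ∧ k e < b' then 1 else 0)) : ℤ) : ℝ) ≤ 2 * B := by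
  have hr' : (0 : ℝ) < r := by exact_mod_cast hr
  have hq' : (r : ℝ) < q := by exact_mod_cast hrq
  have hs0 : 0 < s := by
    by_contra hc
    nlinarith
  subst hb hb'
  refine sum_cells_le_of_tour hR hh hr (fun θ => lo + s * θ) (fun θ => lo + |s * θ - (q - r)|)
    _ _ _ _ (abs_sub_eq_mul hs0.le) ?_ ?_ ?_ hk hB ?_ ?_
  · intro θ θ'
    simp only [add_sub_add_left_eq_sub]
    exact abs_sub_abs_le_mul hs0.le θ θ'
  · simp only [mul_zero, hs]
    rw [abs_of_neg (by linarith)]; ring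
  · simp only [mul_zero, hs]
    rw [abs_of_pos (by linarith)]; ring
  · intro y h1 h2
    push_cast at h2
    refine ⟨(y - lo) / s, ⟨div_nonneg (by linarith) hs0.le, ?_⟩, ?_⟩
    · rw [div_lt_iff₀ hs0, mul_comm, hs]; linarith
    · rw [mul_div_cancel₀ _ hs0.ne']; ring
  · intro y h1 h2
    push_cast at h2
    -- The visit on the initial backward leg.
    refine ⟨((q - r) - (y - lo)) / s, ⟨div_nonneg (by linarith) hs0.le, ?_⟩, ?_⟩
    · rw [div_lt_iff₀ hs0, mul_comm, hs]; linarith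
    · rw [mul_div_cancel₀ _ hs0.ne', abs_of_neg (by linarith)]; ring

/-- The tours of `sum_cells_le`, reflected. -/
theorem sum_cells_le' (hR : R.Travels G loc 1) (hh : 0 < h) (hr : 0 < r) (hrq : r < q)
    (hs : s * r = q) (lo b lo' : ℤ) (hb : b = lo + q) (hlo : lo' = lo + r)
    (hk : ∀ e ∈ R.served, c + h * (r * z e + k e) < R.time e ∧
      R.time e < c + h * (r * z e + (k e + 1)))
    (hB : ∀ Q : Run n, Q.served ⊆ R.served → Q.Travels G loc s →
      (∀ e ∈ Q.served, Q.time e ∈ Set.Ico (d + h * (r * z e)) (d + h * (r * (z e + 1)))) →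
      (Q.profit : ℝ) ≤ B) :
    ((∑ e ∈ R.served, ((if lo ≤ k e ∧ k e < b then 1 else 0) +
      (if lo' ≤ k e ∧ k e < b then 1 else 0)) : ℤ) : ℝ) ≤ 2 * B := by
  have hr' : (0 : ℝ) < r := by exact_mod_cast hr
  have hq' : (r : ℝ) < q := by exact_mod_cast hrq
  have hs0 : 0 < s := by
    by_contra hc
    nlinarith
  subst hb hlo
  refine sum_cells_le_of_tour hR hh hr (fun θ => lo + s * θ) (fun θ => lo + q - |s * θ - r|)
    _ _ _ _ (abs_sub_eq_mul hs0.le) ?_ ?_ ?_ hk hB ?_ ?_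
  · intro θ θ'
    simp only [sub_sub_sub_cancel_left]
    rw [abs_sub_comm]
    exact abs_sub_abs_le_mul hs0.le θ θ'
  · simp only [mul_zero, hs]
    rw [abs_of_neg (by linarith)]; ring
  · simp only [mul_zero, hs]
    rw [abs_of_pos (by linarith)]; ring
  · intro y h1 h2
    push_cast at h2
    refine ⟨(y - lo) / s, ⟨div_nonneg (by linarith) hs0.le, ?_⟩, ?_⟩
    · rw [div_lt_iff₀ hs0, mul_comm, hs]; linarith
    · rw [mul_div_cancel₀ _ hs0.ne']; ring
  · intro y h1 h2
    push_cast at h1 h2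
    -- The visit on the final backward leg, after the turn at `lo + q`.
    refine ⟨(r + (lo + q - y)) / s, ⟨div_nonneg (by linarith) hs0.le, ?_⟩, ?_⟩
    · rw [div_lt_iff₀ hs0, mul_comm, hs]; linarith
    · rw [mul_div_cancel₀ _ hs0.ne', abs_of_pos (by linarith)]; ring

/-- Four tour patterns with weights 3, 3, 1, 1, each contributing at most `2 * B`. The reflection `k
↦ 2r - 1 - k` of the possible cells exchanges the first pattern with the second and the third with
the fourth. -/
theorem sum_coverWeight_le (hR : R.Travels G loc 1) (hh : 0 < h) (hr : 0 < r) (hrq : r < q)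
    (hs : s * r = q)
    (hk : ∀ e ∈ R.served, c + h * (r * z e + k e) < R.time e ∧
      R.time e < c + h * (r * z e + (k e + 1)))
    (hB : ∀ Q : Run n, Q.served ⊆ R.served → Q.Travels G loc s →
      (∀ e ∈ Q.served, Q.time e ∈ Set.Ico (d + h * (r * z e)) (d + h * (r * (z e + 1)))) →
      (Q.profit : ℝ) ≤ B) :
    ((∑ e ∈ R.served, coverWeight r q (k e) : ℤ) : ℝ) ≤ 16 * B := by
  have h1 := sum_cells_le hR hh hr hrq hs (-r) (q - r) (q - 2 * r) (by ring) (by ring) hk hB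
  have h2 := sum_cells_le' hR hh hr hrq hs (3 * r - q) (3 * r) (4 * r - q) (by ring) (by ring)
    hk hB
  have h3 := sum_cells_le hR hh hr hrq hs (4 * r - 2 * q) (4 * r - q) (3 * r - q) (by ring)
    (by ring) hk hB
  have h4 := sum_cells_le' hR hh hr hrq hs (q - 2 * r) (2 * q - 2 * r) (q - r) (by ring) (by ring)
    hk hB
  have gen : ∀ F₁ F₂ F₃ F₄ : Fin n → ℤ,
      ∑ e ∈ R.served, (3 * F₁ e + 3 * F₂ e + F₃ e + F₄ e) = 3 * ∑ e ∈ R.served, F₁ e +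
        3 * ∑ e ∈ R.served, F₂ e + ∑ e ∈ R.served, F₃ e + ∑ e ∈ R.served, F₄ e := by
    intro F₁ F₂ F₃ F₄
    simp only [Finset.sum_add_distrib, Finset.mul_sum]
  simp only [coverWeight]
  rw [gen, Int.cast_add, Int.cast_add, Int.cast_add, Int.cast_mul, Int.cast_mul, Int.cast_ofNat]
  linarith

end Cells

/-! ### Averaging over the period starting points -/

/-- The window `[w, w + L)` completely fills exactly the periods number `z` and `z + 1`. -/
def FillsTwo (τ w L : ℝ) (z : ℤ) : Prop :=
  τ + (z - 1) * (1 / 2) < w ∧ w < τ + z * (1 / 2) ∧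
    τ + (z + 2) * (1 / 2) < w + L ∧ w + L < τ + (z + 3) * (1 / 2)

/-- Double counting over pairs of a starting point `j` and a request. In `H`, `τ` is the starting
point actually used, off the end points; the weak inequalities place the windows relative to the
exact grid point `b + j / (2 * r)`. -/
theorem profit_le_of_grid {N n : ℕ} {I : Instance N n} {R : Run n} (hR : I.IsRun 1 R)
    {r q : ℤ} (hr : 0 < r) (h2 : 2 * r ≤ q) (h5 : 2 * q ≤ 5 * r) {s : ℝ} (hs : (q : ℝ) / r ≤ s)
    (b B : ℝ)
    (H : ∀ j : ℤ, 0 ≤ j → j < r → ∃ τ : ℝ,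
      (∀ e, ∃ z : ℤ, FillsTwo τ (I.start e) (I.len e) z ∧
        b + j / (2 * r) + (z - 1) * (1 / 2) < I.start e ∧
        I.start e ≤ b + j / (2 * r) + z * (1 / 2) ∧
        I.start e + I.len e ≤ b + j / (2 * r) + (z + 3) * (1 / 2)) ∧
      ∀ Q : Run n, Q.Travels I.graph I.loc s →
        (∀ e ∈ Q.served, ∃ z : ℤ, FillsTwo τ (I.start e) (I.len e) z ∧
          Q.time e ∈ Set.Ico (τ + z * (1 / 2)) (τ + (z + 1) * (1 / 2))) → (Q.profit : ℝ) ≤ B) :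
    (4 * q - 2 * r) * (R.profit : ℝ) ≤ 16 * r * B := by
  have hr' : (0 : ℝ) < r := by exact_mod_cast hr
  set h : ℝ := 1 / (2 * r) with hh
  have hpos : 0 < h := by positivity
  have hrh : h * r = 1 / 2 := by rw [hh]; field_simp
  obtain ⟨R', hserved, hR', hoff⟩ := hR.exists_off_grid b h hpos
  have hprof : R.profit = R'.served.card := by rw [hserved]; rfl
  rw [hprof]
  have H' : ∀ j : ℤ, ∃ τ : ℝ, 0 ≤ j → j < r →
      (∀ e, ∃ z : ℤ, FillsTwo τ (I.start e) (I.len e) z ∧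
        b + j / (2 * r) + (z - 1) * (1 / 2) < I.start e ∧
        I.start e ≤ b + j / (2 * r) + z * (1 / 2) ∧
        I.start e + I.len e ≤ b + j / (2 * r) + (z + 3) * (1 / 2)) ∧
      ∀ Q : Run n, Q.Travels I.graph I.loc s →
        (∀ e ∈ Q.served, ∃ z : ℤ, FillsTwo τ (I.start e) (I.len e) z ∧
          Q.time e ∈ Set.Ico (τ + z * (1 / 2)) (τ + (z + 1) * (1 / 2))) → (Q.profit : ℝ) ≤ B := by
    intro j
    by_cases hj : 0 ≤ j ∧ j < r
    · obtain ⟨τ, hτ⟩ := H j hj.1 hj.2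
      exact ⟨τ, fun _ _ => hτ⟩
    · exact ⟨0, fun h1 h2 => absurd ⟨h1, h2⟩ hj⟩
  choose τ hτ using H'
  have Hz : ∀ (j : ℤ) (e : Fin n), ∃ z : ℤ, 0 ≤ j → j < r →
      FillsTwo (τ j) (I.start e) (I.len e) z ∧
        b + j / (2 * r) + (z - 1) * (1 / 2) < I.start e ∧
        I.start e ≤ b + j / (2 * r) + z * (1 / 2) ∧
        I.start e + I.len e ≤ b + j / (2 * r) + (z + 3) * (1 / 2) := by
    intro j e
    by_cases hj : 0 ≤ j ∧ j < r
    · obtain ⟨z, hz⟩ := (hτ j hj.1 hj.2).1 e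
      exact ⟨z, fun _ _ => hz⟩
    · exact ⟨0, fun h1 h2 => absurd ⟨h1, h2⟩ hj⟩
  choose z hz using Hz
  set l : Fin n → ℤ := fun e => ⌊(R'.time e - b) / h⌋ with hl
  have l1 : ∀ e, b + h * l e ≤ R'.time e := fun e => by
    have := Int.floor_le ((R'.time e - b) / h)
    rw [le_div_iff₀ hpos] at this
    simp only [hl]; linarith
  have l2 : ∀ e, R'.time e < b + h * (l e + 1) := fun e => by
    have := Int.lt_floor_add_one ((R'.time e - b) / h)
    rw [div_lt_iff₀ hpos] at this
    simp only [hl]; linarith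
  -- In units of cells, the start of period `z` is the grid line numbered `j + r * z`.
  have hgrid : ∀ (j z : ℤ) (x : ℝ), b + j / (2 * r) + (z + x) * (1 / 2) =
      b + h * ((j + r * z : ℤ) + r * x) := by
    intro j z x
    push_cast
    rw [hh]; field_simp; ring
  have upper : ∀ j ∈ Finset.Ico 0 r,
      ((∑ e ∈ R'.served, coverWeight r q (l e - (j + r * z j e)) : ℤ) : ℝ) ≤ 16 * B := by
    intro j hj
    rw [Finset.mem_Ico] at hj
    refine sum_coverWeight_le (s := q / r) (h := h) (c := b + h * j) (d := τ j) (z := z j)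
      hR'.1 hpos hr (by omega) (by field_simp) ?_ ?_
    · intro e he
      have e1 : b + h * j + h * (r * z j e + (l e - (j + r * z j e) : ℤ)) = b + h * l e := by
        push_cast; ring
      have e2 : b + h * j + h * (r * z j e + ((l e - (j + r * z j e) : ℤ) + 1)) =
          b + h * (l e + 1) := by
        push_cast; ring
      rw [e1, e2]
      exact ⟨lt_of_le_of_ne (l1 e) (hoff e (hserved ▸ he) _).symm, l2 e⟩
    · intro Q hsub hQ hQt
      refine (hτ j hj.1 hj.2).2 Q (fun e he f hf => (hQ e he f hf).trans
        (mul_le_mul_of_nonneg_right hs (abs_nonneg _))) fun e he => ⟨z j e, (hz j e hj.1 hj.2).1, ?_⟩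
      have := hQt e he
      rw [← mul_assoc, ← mul_assoc, hrh] at this
      simpa only [mul_comm (1 / 2 : ℝ)] using this
  have lower : ∀ e ∈ R'.served,
      4 * q - 2 * r ≤ ∑ j ∈ Finset.Ico 0 r, coverWeight r q (l e - (j + r * z j e)) := by
    intro e he
    obtain ⟨t1, t2⟩ := hR'.2 e he
    -- The first grid line at or after the start of the window; the first filled period begins at
    -- one of the lines `g, …, g + r - 1`.
    set g : ℤ := ⌈(I.start e - b) / h⌉ with hg
    have g1 : I.start e ≤ b + h * g := by
      have := Int.le_ceil ((I.start e - b) / h)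
      rw [div_le_iff₀ hpos] at this
      linarith
    have g2 : b + h * (g - 1) < I.start e := by
      have := Int.ceil_lt_add_one ((I.start e - b) / h)
      have := sub_lt_iff_lt_add.2 this
      rw [lt_div_iff₀ hpos] at this
      linarith
    have lt_of : ∀ x y : ℤ, b + h * x < b + h * y → x < y := by
      intro x y hxy
      have : h * (x : ℝ) < h * y := by linarith
      exact_mod_cast lt_of_mul_lt_mul_left this hpos.le
    have hmem : ∀ j ∈ Finset.Ico 0 r, l e - (j + r * z j e) ∈
        Finset.Ico (l e - g + 1 - r) (l e - g + 1) := by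
      intro j hj
      rw [Finset.mem_Ico] at hj ⊢
      obtain ⟨-, a1, a2, -⟩ := hz j e hj.1 hj.2
      have b1 := hgrid j (z j e) (-1)
      have b2 := hgrid j (z j e) 0
      rw [add_zero, mul_zero, add_zero] at b2
      rw [← sub_eq_add_neg] at b1
      rw [b1] at a1
      rw [b2] at a2
      have c1 := lt_of (j + r * z j e - r) g (by push_cast at *; linarith)
      have c2 := lt_of (g - 1) (j + r * z j e) (by push_cast at *; linarith)
      constructor <;> linarith
    -- The line `j + r * z j e` determines `j` modulo `r`, so all `r` lines occur, each once.
    have hinj : Set.InjOn (fun j => l e - (j + r * z j e)) (Finset.Ico 0 r : Finset ℤ) := by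
      intro j hj j' hj' hjj
      rw [Finset.coe_Ico, Set.mem_Ico] at hj hj'
      have h1 : (j + r * z j e) % r = (j' + r * z j' e) % r := by
        congr 1
        simp only at hjj
        linarith
      rwa [Int.add_mul_emod_self_left, Int.add_mul_emod_self_left, Int.emod_eq_of_lt hj.1 hj.2,
        Int.emod_eq_of_lt hj'.1 hj'.2] at h1
    have himg : (Finset.Ico 0 r).image (fun j => l e - (j + r * z j e)) =
        Finset.Ico (l e - g + 1 - r) (l e - g + 1) := by
      refine Finset.eq_of_subset_of_card_le (Finset.image_subset_iff.2 hmem) ?_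
      rw [Finset.card_image_of_injOn hinj]
      simp
    rw [← Finset.sum_image (f := coverWeight r q) hinj, himg]
    refine sum_coverWeight r q _ h2 h5 ?_ ?_
    · have := lt_of (g - 1) (l e + 1) (by push_cast; linarith [l2 e])
      linarith
    -- For the `j` whose first filled period begins exactly at line `g`, the window ends at most
    -- three periods later. This gives `M ≤ 3 * r`.
    · have hg' : l e - g ∈ Finset.Ico (l e - g + 1 - r) (l e - g + 1) := by
        rw [Finset.mem_Ico]; constructor <;> linarith
      rw [← himg, Finset.mem_image] at hg'
      obtain ⟨j, hj, hjg⟩ := hg'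
      rw [Finset.mem_Ico] at hj
      obtain ⟨-, -, -, a3⟩ := hz j e hj.1 hj.2
      rw [hgrid] at a3
      have h6 : j + r * z j e = g := by linarith
      rw [h6] at a3
      have := lt_of (l e) (g + r * 3) (by push_cast; linarith [l1 e])
      linarith
  have hsum : ((∑ e ∈ R'.served, ∑ j ∈ Finset.Ico 0 r,
      coverWeight r q (l e - (j + r * z j e)) : ℤ) : ℝ) ≤ 16 * r * B := by
    rw [Finset.sum_comm, Int.cast_sum]
    refine (Finset.sum_le_sum upper).trans (le_of_eq ?_)
    rw [Finset.sum_const, Int.card_Ico, nsmul_eq_mul]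
    have : (((r - 0).toNat : ℕ) : ℝ) = r := by
      rw [sub_zero]
      exact_mod_cast Int.toNat_of_nonneg hr.le
    rw [this]; ring
  refine le_trans ?_ hsum
  have := Finset.sum_le_sum lower
  rw [Finset.sum_const, nsmul_eq_mul] at this
  have h7 : ((((R'.served.card : ℤ) * (4 * q - 2 * r)) : ℤ) : ℝ) ≤
      ((∑ e ∈ R'.served, ∑ j ∈ Finset.Ico 0 r,
      coverWeight r q (l e - (j + r * z j e)) : ℤ) : ℝ) := by exact_mod_cast this
  push_cast at h7 ⊢
  linarith

/-! ### Step counts and the starting points that are tried -/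

namespace Timed

variable {β δ : Type}

@[simp] theorem bind_val (x : Timed β) (f : β → Timed δ) : (x >>= f).val = (f x.val).val := rfl

@[simp] theorem bind_steps (x : Timed β) (f : β → Timed δ) :
    (x >>= f).steps = x.steps + (f x.val).steps := rfl

@[simp] theorem pure_val (b : β) : (pure b : Timed β).val = b := rfl

@[simp] theorem pure_steps (b : β) : (pure b : Timed β).steps = 0 := rfl

@[simp] theorem tick_steps (k : ℕ) : (tick k).steps = k := rfl

theorem mapList_steps_le (f : β → Timed δ) (l : List β) (K : ℕ) (h : ∀ x ∈ l, (f x).steps ≤ K) :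
    (mapList f l).steps ≤ l.length * (K + 1) := by
  have := List.sum_le_card_nsmul (l.map fun b => (f b).steps + 1) (K + 1) (by
    intro x hx
    obtain ⟨b, hb, rfl⟩ := List.mem_map.1 hx
    have := h b hb
    omega)
  simpa [mapList] using this

end Timed

section Residue

variable {α : ℝ}

theorem residue_nonneg (hα : 0 < α) (x : ℝ) : 0 ≤ residue α x :=
  mul_nonneg hα.le (Int.fract_nonneg _)

theorem residue_lt (hα : 0 < α) (x : ℝ) : residue α x < α :=
  mul_lt_of_lt_one_right hα (Int.fract_lt_one _)

theorem residue_eq (hα : 0 < α) (x : ℝ) : residue α x = x - ⌊x / α⌋ * α := by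
  rw [residue, Int.fract]
  field_simp

theorem residue_add_mul (hα : 0 < α) (x : ℝ) (z : ℤ) : residue α (x + z * α) = residue α x := by
  rw [residue, residue, add_div, mul_div_cancel_right₀ _ hα.ne', Int.fract_add_intCast]

theorem residue_of_mem (hα : 0 < α) {x : ℝ} (h0 : 0 ≤ x) (h1 : x < α) : residue α x = x := by
  rw [residue, Int.fract_eq_self.2 ⟨div_nonneg h0 hα.le, (div_lt_one hα).2 h1⟩]
  field_simp

end Residue

section StartingPoints

variable {α : ℝ}

theorem leastGap_spec (hα : 0 < α) (b : ℝ) (xs : List ℝ) :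
    0 < (leastGap α b xs).val ∧ (leastGap α b xs).val ≤ α ∧
      (∀ y ∈ xs, 0 < residue α (y - b) → (leastGap α b xs).val ≤ residue α (y - b)) ∧
      (leastGap α b xs).steps = xs.length := by
  induction xs with
  | nil => simp [leastGap, hα]
  | cons x xs ih =>
    obtain ⟨h1, h2, h3, h4⟩ := ih
    have hsteps : (leastGap α b (x :: xs)).steps = (x :: xs).length := by
      rw [List.length_cons, ← h4]
      rfl
    have hval : (leastGap α b (x :: xs)).val = if 0 < residue α (x - b) ∧
        residue α (x - b) < (leastGap α b xs).val then residue α (x - b)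
        else (leastGap α b xs).val := rfl
    simp only [hsteps, hval, List.mem_cons]
    split_ifs with h
    · refine ⟨h.1, h.2.le.trans h2, ?_, trivial⟩
      rintro y (rfl | hy) hpos
      · exact le_rfl
      · exact h.2.le.trans (h3 y hy hpos)
    · refine ⟨h1, h2, ?_, trivial⟩
      rintro y (rfl | hy) hpos
      · by_contra hc
        exact h ⟨hpos, not_le.1 hc⟩
      · exact h3 y hy hpos

theorem nudge_steps (hα : 0 < α) (xs : List ℝ) (b : ℝ) :
    (nudge α xs b).steps = xs.length + 1 := by
  simp [nudge, (leastGap_spec hα b xs).2.2.2]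

/-- Moving the starting point off the end points does not change which end points lie before a
period boundary. -/
theorem le_iff_lt_nudge (hα : 0 < α) {xs : List ℝ} (b : ℝ) {y : ℝ} (hy : y ∈ xs) (z : ℤ) :
    y ≤ b + z * α ↔ y < (nudge α xs b).val + z * α := by
  obtain ⟨h1, h2, h3, -⟩ := leastGap_spec hα b xs
  simp only [nudge, Timed.bind_val, Timed.pure_val]
  constructor
  · intro h; linarith
  · intro h
    by_contra hc
    -- Otherwise `y` would lie after the boundary by less than half of the least gap.
    have e : residue α (y - b) = y - b - z * α := by
      have : y - b = (y - b - z * α) + z * α := by ring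
      rw [this, residue_add_mul hα, residue_of_mem hα (by linarith) (by linarith)]
      ring
    have := h3 y hy (by rw [e]; linarith)
    rw [e] at this
    linarith

theorem search_val (d : ℝ) (l : List ℝ) : (search d l).val = true ↔ d ∈ l := by
  induction l with
  | nil => simp [search]
  | cons x l ih =>
    simp only [search, Timed.bind_val, List.mem_cons]
    split_ifs with h
    · simp [h]
    · simp [h, ih]

theorem search_steps (d : ℝ) (l : List ℝ) : (search d l).steps ≤ l.length := by
  induction l with
  | nil => simp [search]
  | cons x l ih =>
    simp only [search, Timed.bind_steps, List.length_cons, Timed.tick_steps]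
    split_ifs with h
    · simp
    · omega

/-- The accumulator consists of distinct elements of `S` and never outgrows `r`, so each search
costs at most `k`. -/
theorem distinctResidues_spec (α : ℝ) (r : ℕ∞) (S : Finset ℝ) (k : ℕ) (hk : min r S.card ≤ k)
    (xs : List ℝ) (hxs : ∀ x ∈ xs, residue α x ∈ S) :
    ∀ acc : List ℝ, acc.Nodup → (∀ d ∈ acc, d ∈ S) → (acc.length : ℕ∞) ≤ r →
      (distinctResidues α r xs acc).steps ≤ xs.length * (k + 1) ∧
      (∀ ρ, (distinctResidues α r xs acc).val = some ρ →
        ρ.length ≤ k ∧ (∀ d ∈ acc, d ∈ ρ) ∧ ∀ x ∈ xs, residue α x ∈ ρ) ∧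
      ((distinctResidues α r xs acc).val = none → r < S.card) := by
  have card_le : ∀ l : List ℝ, l.Nodup → (∀ d ∈ l, d ∈ S) → l.length ≤ S.card := by
    intro l hl hS
    rw [← List.toFinset_card_of_nodup hl]
    exact Finset.card_le_card fun d hd => hS d (List.mem_toFinset.1 hd)
  induction xs with
  | nil =>
    intro acc h1 h2 h3
    have : acc.length ≤ k := by
      have := (le_min h3 (by exact_mod_cast card_le acc h1 h2)).trans hk
      exact_mod_cast this
    simp only [distinctResidues, Timed.pure_val, Timed.pure_steps]
    refine ⟨by omega, ?_, by simp⟩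
    rintro ρ hρ
    obtain rfl := Option.some.inj hρ
    simpa using this
  | cons x xs ih =>
    intro acc h1 h2 h3
    have hlen : acc.length ≤ k := by
      have := (le_min h3 (by exact_mod_cast card_le acc h1 h2)).trans hk
      exact_mod_cast this
    have hsearch := search_steps (residue α x) acc
    have ih' := ih fun y hy => hxs y (List.mem_cons_of_mem _ hy)
    simp only [distinctResidues, Timed.bind_val, Timed.bind_steps, Timed.tick_steps,
      search_val, List.length_cons]
    by_cases hmem : residue α x ∈ acc
    · simp only [hmem, if_true]
      obtain ⟨a1, a2, a3⟩ := ih' acc h1 h2 h3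
      refine ⟨by rw [add_mul]; omega, fun ρ hρ => ?_, a3⟩
      obtain ⟨b1, b2, b3⟩ := a2 ρ hρ
      refine ⟨b1, b2, fun y hy => ?_⟩
      rcases List.mem_cons.1 hy with rfl | hy
      · exact b2 _ hmem
      · exact b3 y hy
    · simp only [hmem, if_false]
      have hnd : (residue α x :: acc).Nodup := List.nodup_cons.2 ⟨hmem, h1⟩
      have hS : ∀ d ∈ residue α x :: acc, d ∈ S := by
        intro d hd
        rcases List.mem_cons.1 hd with rfl | hd
        · exact hxs x List.mem_cons_self
        · exact h2 d hd
      by_cases hr : (acc.length : ℕ∞) < r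
      · simp only [hr, if_true]
        obtain ⟨a1, a2, a3⟩ := ih' (residue α x :: acc) hnd hS (by
          rw [List.length_cons]; push_cast; exact Order.add_one_le_of_lt hr)
        refine ⟨by rw [add_mul]; omega, fun ρ hρ => ?_, a3⟩
        obtain ⟨b1, b2, b3⟩ := a2 ρ hρ
        refine ⟨b1, fun d hd => b2 d (List.mem_cons_of_mem _ hd), fun y hy => ?_⟩
        rcases List.mem_cons.1 hy with rfl | hy
        · exact b2 _ List.mem_cons_self
        · exact b3 y hy
      · simp only [hr, if_false, Timed.pure_val, Timed.pure_steps]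
        refine ⟨by rw [add_mul]; omega, by simp, fun _ => ?_⟩
        have := card_le _ hnd hS
        rw [List.length_cons] at this
        refine lt_of_le_of_lt (not_lt.1 hr) ?_
        exact_mod_cast this

variable {N n : ℕ}

theorem mem_endpoints (I : Instance N n) (y : ℝ) :
    y ∈ (endpoints I).val ↔ ∃ e, y = I.start e ∨ y = I.start e + I.len e := by
  simp [endpoints]

theorem endpoints_length (I : Instance N n) : (endpoints I).val.length = 2 * n := by
  simp [endpoints, List.length_flatMap, mul_comm]

/-- The residues modulo `α` of the end points of windows. -/
noncomputable def residues (α : ℝ) (I : Instance N n) : Finset ℝ :=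
  (endpoints I).val.toFinset.image (residue α)

theorem card_residues_half (I : Instance N n) : (residues (1 / 2) I).card = numPeriodSets I := by
  rw [numPeriodSets, ← Set.ncard_coe_finset]
  congr 1
  ext d
  simp only [residues, Finset.coe_image, List.coe_toFinset, Set.mem_image, Set.mem_ofPred_eq,
    mem_endpoints, Set.mem_union, Set.mem_range]
  constructor
  · rintro ⟨y, ⟨e, rfl | rfl⟩, rfl⟩
    · exact Or.inl ⟨e, rfl⟩
    · exact Or.inr ⟨e, rfl⟩
  · rintro (⟨e, rfl⟩ | ⟨e, rfl⟩)
    · exact ⟨_, ⟨e, Or.inl rfl⟩, rfl⟩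
    · exact ⟨_, ⟨e, Or.inr rfl⟩, rfl⟩

/-- Since 3 is a multiple of `α`, a residue modulo 3 determines the one modulo `α`. Each residue
modulo `1/2` comes from 6 residues modulo 3. The lengths `1/2`, `3/4`, `1` all divide 3. -/
theorem card_residues_le (hα : 0 < α) {t : ℤ} (ht : 3 = t * α) (I : Instance N n) :
    (residues α I).card ≤ 6 * numPeriodSets I := by
  rw [← card_residues_half]
  have : residues α I ⊆ (Finset.range 6 ×ˢ residues (1 / 2) I).image
      (fun p => residue α (p.2 + p.1 * (1 / 2))) := by
    intro d hd
    obtain ⟨y, hy, rfl⟩ := Finset.mem_image.1 hd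
    refine Finset.mem_image.2 ⟨((⌊y / (1 / 2)⌋ % 6).toNat, residue (1 / 2) y), ?_, ?_⟩
    · rw [Finset.mem_product, Finset.mem_range]
      exact ⟨by simp only; omega, Finset.mem_image_of_mem _ hy⟩
    · simp only
      rw [residue_eq (by norm_num : (0 : ℝ) < 1 / 2)]
      set f := ⌊y / (1 / 2)⌋
      have h1 : (((f % 6).toNat : ℕ) : ℝ) = ((f % 6 : ℤ) : ℝ) := by
        exact_mod_cast Int.toNat_of_nonneg (Int.emod_nonneg f (by norm_num))
      have h2 : (f : ℝ) = 6 * ((f / 6 : ℤ) : ℝ) + ((f % 6 : ℤ) : ℝ) := by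
        exact_mod_cast (Int.mul_ediv_add_emod f 6).symm
      have h3 : y - f * (1 / 2) + ((f % 6).toNat : ℕ) * (1 / 2) =
          y + ((-(f / 6) * t : ℤ) : ℝ) * α := by
        rw [h1]
        push_cast
        rw [mul_assoc, ← ht, h2]
        ring
      rw [h3, residue_add_mul hα]
  refine (Finset.card_le_card this).trans (Finset.card_image_le.trans ?_)
  rw [Finset.card_product, Finset.card_range]

theorem endpoint_distinctResidues (I : Instance N n) (α : ℝ) (r : ℕ∞) {k : ℕ}
    (hk : min r (residues α I).card ≤ k) :
    (distinctResidues α r (endpoints I).val []).steps ≤ 2 * n * (k + 1) ∧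
      (∀ ρ, (distinctResidues α r (endpoints I).val []).val = some ρ →
        ρ.length ≤ k ∧ ∀ x ∈ (endpoints I).val, residue α x ∈ ρ) ∧
      ((distinctResidues α r (endpoints I).val []).val = none → r < (residues α I).card) := by
  obtain ⟨h1, h2, h3⟩ := distinctResidues_spec α r (residues α I) k hk (endpoints I).val
    (fun x hx => Finset.mem_image_of_mem _ (List.mem_toFinset.2 hx)) [] (by simp) (by simp)
    (by simp)
  rw [endpoints_length] at h1
  exact ⟨h1, fun ρ hρ => ⟨(h2 ρ hρ).1, (h2 ρ hρ).2.2⟩, h3⟩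

theorem startingPoints_bound (hα : 0 < α) (b : ℝ) (r : ℕ∞) (I : Instance N n) {k : ℕ}
    (hk : min r (residues α I).card ≤ k) :
    (startingPoints α b r I).val.length ≤ k ∧
      (startingPoints α b r I).steps ≤ 2 * n + 2 * n * (k + 1) + k * 2 + k * (2 * n + 2) := by
  obtain ⟨h1, h2, h3⟩ := endpoint_distinctResidues I α r hk
  have hn : ∀ bs : List ℝ, (Timed.mapList (nudge α (endpoints I).val) bs).steps ≤
      bs.length * (2 * n + 2) := fun bs => Timed.mapList_steps_le _ _ _ fun x _ => by
    rw [nudge_steps hα, endpoints_length]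
  have hlen : ∀ bs : List ℝ, (Timed.mapList (nudge α (endpoints I).val) bs).val.length =
      bs.length := fun bs => by simp [Timed.mapList]
  have he : (endpoints I).steps = 2 * n := rfl
  simp only [startingPoints, Timed.bind_val, Timed.bind_steps, he]
  cases hD : (distinctResidues α r (endpoints I).val []).val with
  | some ρ =>
    obtain ⟨a1, -⟩ := h2 ρ hD
    simp only [Timed.bind_val, Timed.bind_steps, Timed.pure_val, Timed.pure_steps, hlen]
    have := hn ρ
    have := Nat.mul_le_mul_right (2 * n + 2) a1
    exact ⟨a1, by omega⟩
  | none =>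
    have hr := h3 hD
    rw [min_eq_left hr.le] at hk
    have hr' : r.toNat ≤ k := ENat.toNat_le_of_le_natCast hk
    simp only [Timed.bind_val, Timed.bind_steps, hlen]
    have e1 : ∀ f : ℕ → Timed ℝ, (Timed.mapList f (List.range r.toNat)).val.length = r.toNat :=
      fun f => by simp [Timed.mapList]
    have e2 := Timed.mapList_steps_le (fun j : ℕ => (do
        Timed.tick 1
        pure (b + j * α / (r.toNat : ℝ)) : Timed ℝ)) (List.range r.toNat) 1 (by simp)
    have e3 := hn (Timed.mapList (fun j : ℕ => (do
        Timed.tick 1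
        pure (b + j * α / (r.toNat : ℝ)) : Timed ℝ)) (List.range r.toNat)).val
    rw [e1] at e3 ⊢
    rw [List.length_range] at e2
    refine ⟨hr', ?_⟩
    have := Nat.mul_le_mul_right (2 * n + 2) hr'
    omega

/-- Every starting point `t` of the grid (every real `t` if `r = ⊤`) has the same end points of
windows before its period boundaries as some starting point that is tried. -/
theorem exists_startingPoint (hα : 0 < α) (b : ℝ) (r : ℕ∞) (I : Instance N n) (hn : 0 < n)
    (t : ℝ) (ht : r = ⊤ ∨ ∃ j < r.toNat, t = b + j * α / r.toNat) :
    ∃ τ ∈ (startingPoints α b r I).val, ∃ m : ℤ, ∀ y ∈ (endpoints I).val, ∀ z : ℤ,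
      y ≤ t + z * α ↔ y < τ + m * α + z * α := by
  obtain ⟨-, h2, h3⟩ := endpoint_distinctResidues I α r
    (k := (residues α I).card) (min_le_right _ _)
  simp only [startingPoints, Timed.bind_val]
  cases hD : (distinctResidues α r (endpoints I).val []).val with
  | none =>
    have hr := h3 hD
    rcases ht with rfl | ⟨j, hj, rfl⟩
    · simp at hr
    · refine ⟨(nudge α (endpoints I).val (b + j * α / r.toNat)).val, ?_, 0, fun y hy z => ?_⟩
      · simp only [Timed.mapList, Timed.bind_val, List.map_map, List.mem_map]
        exact ⟨j, List.mem_range.2 hj, rfl⟩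
      · rw [le_iff_lt_nudge hα _ hy, Int.cast_zero, zero_mul, add_zero]
  | some ρ =>
    obtain ⟨-, hρ⟩ := h2 ρ hD
    have hne : ρ.toFinset.Nonempty := ⟨residue α (I.start ⟨0, hn⟩), List.mem_toFinset.2
      (hρ _ ((mem_endpoints I _).2 ⟨⟨0, hn⟩, Or.inl rfl⟩))⟩
    -- The last end point, modulo `α`, at or before `t`: moving the boundary from `d` to `t` passes
    -- no end point.
    obtain ⟨d, hd, hmin⟩ := Finset.exists_min_image ρ.toFinset (fun d => residue α (t - d)) hne
    rw [List.mem_toFinset] at hd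
    refine ⟨(nudge α (endpoints I).val d).val, ?_, ⌊(t - d) / α⌋, fun y hy z => ?_⟩
    · simp only [Timed.mapList, Timed.bind_val, Timed.pure_val, List.mem_map]
      exact ⟨d, hd, rfl⟩
    · have e1 := residue_eq hα (t - d)
      have e2 := le_iff_lt_nudge hα d hy (⌊(t - d) / α⌋ + z)
      have e3 := residue_nonneg hα (t - d)
      have e4 := residue_lt hα (t - d)
      push_cast at e2
      rw [add_mul, ← add_assoc, ← add_assoc] at e2
      rw [← e2]
      constructor
      · intro h
        by_contra hc
        have h5 := hmin _ (List.mem_toFinset.2 (hρ y hy))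
        have h6 : t - residue α y = (t + z * α - y) + ((⌊y / α⌋ - z : ℤ) : ℝ) * α := by
          rw [residue_eq hα y]; push_cast; ring
        rw [h6, residue_add_mul hα,
          residue_of_mem hα (x := t + z * α - y) (by linarith) (by linarith)] at h5
        linarith
      · intro h
        linarith

end StartingPoints

/-! ### Trimming and retaining the best run -/

section Trim

variable {N n : ℕ}

theorem trimWindow_of_fillsTwo {τ w L : ℝ} {z : ℤ} (h : FillsTwo τ w L z) :
    trimWindow (1 / 2) τ (scheme3 1 1) w L = some z := by
  obtain ⟨h1, h2, h3, h4⟩ := h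
  have e1 : ⌊(w - τ) / (1 / 2)⌋ = z - 1 := by
    rw [Int.floor_eq_iff]; push_cast; constructor <;> linarith
  have e2 : ⌊(w + L - τ) / (1 / 2)⌋ = z + 2 := by
    rw [Int.floor_eq_iff]; push_cast; constructor <;> linarith
  simp only [trimWindow, e1, e2]
  have e3 : (z + 2 - (z - 1 + 1)).toNat = 2 := by omega
  rw [e3]
  simp [scheme3]

/-- A scheme that trims windows to a period which they completely fill. -/
def Scheme.Valid (c : Scheme) : Prop := ∀ l j, c l = some j → 1 ≤ j ∧ j ≤ l

theorem trimWindow_subset {α τ w L : ℝ} (hα : 0 < α) {c : Scheme} (hc : c.Valid) {z : ℤ}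
    (h : trimWindow α τ c w L = some z) :
    Set.Ico (τ + z * α) (τ + (z + 1) * α) ⊆ Set.Ico w (w + L) := by
  simp only [trimWindow, Option.map_eq_some_iff, Option.bind_eq_bind, Option.bind_eq_some_iff,
    Option.pure_def, Option.some.injEq] at h
  obtain ⟨_, ⟨j, hj, rfl⟩, rfl⟩ := h
  obtain ⟨h1, h2⟩ := hc _ _ hj
  have h3 := Int.lt_floor_add_one ((w - τ) / α)
  have h4 := Int.floor_le ((w + L - τ) / α)
  rw [div_lt_iff₀ hα] at h3
  rw [le_div_iff₀ hα] at h4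
  set a := ⌊(w - τ) / α⌋
  set b := ⌊(w + L - τ) / α⌋
  have h5 : a + j + 1 ≤ b := by omega
  have h5' : (a : ℝ) + j + 1 ≤ b := by exact_mod_cast h5
  have h1' : (1 : ℝ) ≤ j := by exact_mod_cast h1
  push_cast
  refine Set.Ico_subset_Ico ?_ ?_
  · nlinarith
  · nlinarith

theorem TrimmedInstance.IsRun.isRun {I : Instance N n} {α τ s : ℝ} (hα : 0 < α) {c : Scheme}
    (hc : c.Valid) {R : Run n} (hR : (trim I α τ c).val.IsRun s R) : I.IsRun s R := by
  refine ⟨hR.1, fun e he => ?_⟩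
  obtain ⟨z, hz, ht⟩ := hR.2 e he
  exact trimWindow_subset hα hc hz ht

theorem trim_steps (I : Instance N n) (α τ : ℝ) (c : Scheme) : (trim I α τ c).steps = 2 * n := by
  simp [trim, Timed.tabulate, mul_comm]

theorem scheme1_valid : Scheme.Valid scheme1 := by
  intro l j h
  unfold scheme1 at h
  split at h <;> simp_all

theorem scheme2_valid {i : ℕ} (h1 : 1 ≤ i) (h2 : i ≤ 2) : Scheme.Valid (scheme2 i) := by
  intro l j h
  unfold scheme2 at h
  split at h <;> simp at h <;> omega

theorem scheme3_valid {i k : ℕ} (h1 : 1 ≤ i) (h2 : i ≤ 2) (h3 : 1 ≤ k) (h4 : k ≤ 3) :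
    Scheme.Valid (scheme3 i k) := by
  intro l j h
  unfold scheme3 at h
  split at h <;> simp at h <;> omega

end Trim

section RetainBest

variable {n : ℕ} {ι : Type}

theorem retainBest_induction (f : ι → Timed (Run n)) (p : Run n → Prop) (l : List ι)
    (hf : ∀ x ∈ l, p (f x).val) : ∀ R, p R → p (retainBest f l R).val := by
  induction l with
  | nil => exact fun R hR => hR
  | cons x l ih =>
    intro R hR
    refine ih (fun y hy => hf y (List.mem_cons_of_mem _ hy)) _ ?_
    simp only [better]
    split_ifs
    · exact hf x List.mem_cons_self
    · exact hR

theorem le_profit_retainBest (f : ι → Timed (Run n)) (l : List ι) :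
    ∀ R, R.profit ≤ (retainBest f l R).val.profit ∧
      ∀ x ∈ l, (f x).val.profit ≤ (retainBest f l R).val.profit := by
  induction l with
  | nil => exact fun R => ⟨le_rfl, by simp⟩
  | cons x l ih =>
    intro R
    obtain ⟨h1, h2⟩ := ih (better R (f x).val).val
    have h3 : R.profit ≤ (better R (f x).val).val.profit := by
      simp only [better]; split_ifs <;> omega
    have h4 : (f x).val.profit ≤ (better R (f x).val).val.profit := by
      simp only [better]; split_ifs <;> omega
    refine ⟨h3.trans h1, fun y hy => ?_⟩
    rcases List.mem_cons.1 hy with rfl | hy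
    · exact h4.trans h1
    · exact h2 y hy

theorem retainBest_steps_le (f : ι → Timed (Run n)) (K : ℕ) (l : List ι)
    (hf : ∀ x ∈ l, (f x).steps ≤ K) :
    ∀ R, (retainBest f l R).steps ≤ l.length * (K + (2 * n + 1)) := by
  induction l with
  | nil => exact fun R => Nat.zero_le _
  | cons x l ih =>
    intro R
    have h1 := ih (fun y hy => hf y (List.mem_cons_of_mem _ hy)) (better R (f x).val).val
    have h2 := hf x List.mem_cons_self
    have h3 : (retainBest f (x :: l) R).steps = (f x).steps + ((2 * n + 1) +
      (retainBest f l (better R (f x).val).val).steps) := rfl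
    rw [h3, List.length_cons, add_mul]
    omega

end RetainBest

/-! ### Validity, profit and cost of SPEEDUP -/

section Speedup

variable {N n : ℕ} {𝒢 : GraphClass} {γ : ℝ} {Γ : ℕ → ℕ} {alg : TrimmedAlg}
  (halg : IsTrimmedApprox 𝒢 γ Γ alg) {I : Instance N n} (hI : 𝒢 N I.graph)

include halg hI

theorem speedup_isRun {s α : ℝ} (hs : 0 < s) (hα : 0 < α) (r : ℕ∞) (b : ℝ) {c : Scheme}
    (hc : c.Valid) : I.IsRun s (speedup alg s r I α b c).val := by
  refine retainBest_induction _ _ _ (fun τ _ => ?_) _ ⟨?_, ?_⟩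
  · exact TrimmedInstance.IsRun.isRun hα hc (halg N n (trim I α τ c).val s hI hα hs).1
  · intro e he
    simp [Run.empty] at he
  · intro e he
    simp [Run.empty] at he

theorem profit_le_speedup {s α : ℝ} (hγ : 0 ≤ γ) (hs : 0 < s) (hα : 0 < α) (r : ℕ∞) (b : ℝ)
    (c : Scheme) {τ : ℝ} (hτ : τ ∈ (startingPoints α b r I).val) {Q : Run n}
    (hQ : (trim I α τ c).val.IsRun s Q) :
    (Q.profit : ℝ) ≤ γ * (speedup alg s r I α b c).val.profit := by
  refine ((halg N n (trim I α τ c).val s hI hα hs).2.1 Q hQ).trans ?_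
  refine mul_le_mul_of_nonneg_left ?_ hγ
  exact_mod_cast (le_profit_retainBest (fun τ => do
    let T ← trim I α τ c
    alg T s) (startingPoints α b r I).val (Run.empty n)).2 τ hτ

theorem speedup_steps_le {s α : ℝ} (hs : 0 < s) (hα : 0 < α) (r : ℕ∞) (b : ℝ) (c : Scheme)
    (hn : 0 < n) (hΓ : N + n ≤ Γ (N + n)) {k : ℕ} (hk : min r (residues α I).card ≤ k)
    (hk0 : 0 < k) :
    (speedup alg s r I α b c).steps ≤ 20 * (k * Γ (N + n)) := by
  obtain ⟨h1, h2⟩ := startingPoints_bound hα b r I hk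
  have h3 := retainBest_steps_le (fun τ => do
    let T ← trim I α τ c
    alg T s) (2 * n + Γ (N + n)) (startingPoints α b r I).val (fun τ _ => by
      rw [Timed.bind_steps, trim_steps]
      exact Nat.add_le_add_left (halg N n (trim I α τ c).val s hI hα hs).2.2 _) (Run.empty n)
  have h4 : (speedup alg s r I α b c).steps = (startingPoints α b r I).steps +
    (retainBest (fun τ => do
    let T ← trim I α τ c
    alg T s) (startingPoints α b r I).val (Run.empty n)).steps := rfl
  rw [h4]
  have h5 := Nat.mul_le_mul_right (2 * n + Γ (N + n) + (2 * n + 1)) h1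
  refine (Nat.add_le_add h2 (h3.trans h5)).trans ?_
  generalize Γ (N + n) = g at *
  -- The cost is at most `4n + 8kn + 5k + kg`, and each of `n`, `kn`, `k` is at most `kg`.
  have h6 : k * n ≤ k * g := Nat.mul_le_mul_left k (by omega)
  have h7 : k * 1 ≤ k * n := Nat.mul_le_mul_left k hn
  have h8 : 1 * n ≤ k * n := Nat.mul_le_mul_right n hk0
  nlinarith

end Speedup

theorem mem_calls {call : Call} (h : call ∈ phase1 ++ phase2 ++ phase3) :
    0 < call.α ∧ (∃ t : ℤ, 3 = t * call.α) ∧ call.c.Valid := by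
  rw [List.mem_append, List.mem_append] at h
  rcases h with (h | h) | h
  · simp only [phase1, List.mem_flatMap, List.mem_map] at h
    obtain ⟨i, -, j, hj, k, hk, rfl⟩ := h
    refine ⟨by norm_num, ⟨6, by norm_num⟩, scheme3_valid ?_ ?_ ?_ ?_⟩ <;>
      simp at hj hk <;> omega
  · simp only [phase2, List.mem_flatMap, List.mem_map] at h
    obtain ⟨i, -, j, hj, rfl⟩ := h
    refine ⟨by norm_num, ⟨4, by norm_num⟩, scheme2_valid ?_ ?_⟩ <;>
      simp at hj <;> omega
  · simp only [phase3, List.mem_map] at h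
    obtain ⟨i, -, rfl⟩ := h
    exact ⟨by norm_num, ⟨3, by norm_num⟩, scheme1_valid⟩

theorem mem_phase1 {i : ℕ} (hi : i < 2) : (⟨1 / 2, i / 4, scheme3 1 1⟩ : Call) ∈ phase1 := by
  simp only [phase1, List.mem_flatMap, List.mem_map]
  exact ⟨i, by simp; omega, 1, by simp, 1, by simp, rfl⟩

theorem numPeriodSets_pos {N n : ℕ} (I : Instance N n) (hn : 0 < n) : 0 < numPeriodSets I := by
  rw [← card_residues_half, Finset.card_pos]
  exact ⟨_, Finset.mem_image_of_mem _ (List.mem_toFinset.2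
    ((mem_endpoints I _).2 ⟨⟨0, hn⟩, Or.inl rfl⟩))⟩

/-! ### SPEEDUPW12 -/

section SpeedupW12

variable {N n : ℕ} {𝒢 : GraphClass} {γ : ℝ} {Γ : ℕ → ℕ} {alg : TrimmedAlg}
  (halg : IsTrimmedApprox 𝒢 γ Γ alg) {I : Instance N n} (hI : 𝒢 N I.graph)

include halg hI

theorem speedupW12_isRun {s : ℝ} (hs : 0 < s) (r : ℕ∞) :
    I.IsRun s (speedupW12 alg s r I).val := by
  refine retainBest_induction _ _ _ (fun call h => ?_) _ ⟨?_, ?_⟩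
  · obtain ⟨h1, -, h2⟩ := mem_calls h
    exact speedup_isRun halg hI hs h1 r _ h2
  · intro e he
    simp [Run.empty] at he
  · intro e he
    simp [Run.empty] at he

theorem speedupW12_steps_le {s : ℝ} (hs : 0 < s) {r : ℕ∞} (hr : r ≠ 0) (hn : 0 < n)
    (hΓ : N + n ≤ Γ (N + n)) :
    ((speedupW12 alg s r I).steps : ℕ∞) ≤
      (3000 : ℕ) * min r (numPeriodSets I) * Γ (N + n) := by
  have hm := numPeriodSets_pos I hn
  obtain ⟨k, hk⟩ : ∃ k : ℕ, (k : ℕ∞) = min r (numPeriodSets I) :=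
    ENat.ne_top_iff_exists.1 (ne_top_of_le_ne_top (ENat.natCast_ne_top _) (min_le_right _ _))
  have hk0 : 0 < k := by
    have : (0 : ℕ∞) < k := by
      rw [hk]
      exact lt_min (pos_iff_ne_zero.2 hr) (by exact_mod_cast hm)
    exact_mod_cast this
  have hcall : ∀ call ∈ phase1 ++ phase2 ++ phase3,
      (speedup alg s r I call.α call.b call.c).steps ≤ 20 * (6 * k * Γ (N + n)) := by
    intro call h
    obtain ⟨h1, ⟨t, ht⟩, -⟩ := mem_calls h
    refine speedup_steps_le halg hI hs h1 r _ _ hn hΓ ?_ (by omega)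
    have h2 : ((residues call.α I).card : ℕ∞) ≤ (6 * numPeriodSets I : ℕ) := by
      exact_mod_cast card_residues_le h1 ht I
    push_cast at h2 ⊢
    rw [hk]
    rcases le_total r (numPeriodSets I : ℕ∞) with h | h
    · rw [min_eq_left h]
      exact (min_le_left _ _).trans (le_mul_of_one_le_left zero_le (by norm_num))
    · rw [min_eq_right h]
      exact (min_le_right _ _).trans h2
  have h1 := retainBest_steps_le (fun call : Call => speedup alg s r I call.α call.b call.c)
    (20 * (6 * k * Γ (N + n))) _ hcall (Run.empty n)
  -- There are 12 + 6 + 4 calls, and `22 * (120 + 3) ≤ 3000`.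
  have h2 : (phase1 ++ phase2 ++ phase3).length = 22 := by
    simp [phase1, phase2, phase3]
  rw [h2] at h1
  rw [← hk]
  have h3 : (speedupW12 alg s r I).steps ≤ 3000 * k * Γ (N + n) := by
    refine h1.trans ?_
    generalize Γ (N + n) = g at *
    have h6 : 1 * g ≤ k * g := Nat.mul_le_mul_right g hk0
    rw [mul_assoc 6, mul_assoc 3000]
    omega
  exact_mod_cast h3

/-- Only the call with `b = i / 4` that trims W_2 to the first filled period is needed. The ratio `q
/ p` may be smaller than `s`, which leaves room for approximation. -/
theorem profit_le_of_ratio {s : ℝ} (hγ : 0 ≤ γ) (hs : 0 < s) {r : ℕ∞} (hn : 0 < n) {i : ℕ}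
    (hi : i < 2)
    (hW : ∀ τ ∈ (startingPoints (1 / 2) (i / 4) r I).val,
        ∀ e, InW 2 (1 / 2) τ (I.start e) (I.len e))
    {R : Run n} (hR : I.IsRun 1 R) {p q : ℕ} (hp : 0 < p) (h2 : 2 * p ≤ q) (h5 : 2 * q ≤ 5 * p)
    (hqs : (q : ℝ) / p ≤ s) (hr : r = ⊤ ∨ r = p) :
    (4 * q - 2 * p) * (R.profit : ℝ) ≤
      16 * p * (γ * (speedupW12 alg s r I).val.profit) := by
  have := profit_le_of_grid hR (r := p) (q := q) (by exact_mod_cast hp) (by exact_mod_cast h2)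
    (by exact_mod_cast h5) (s := s) (by rwa [Int.cast_natCast, Int.cast_natCast]) (i / 4)
    (γ * (speedupW12 alg s r I).val.profit) ?_
  · exact_mod_cast this
  intro j hj0 hjp
  lift j to ℕ using hj0
  have hjp' : j < p := by exact_mod_cast hjp
  obtain ⟨τ, hτ, m, hm⟩ := exists_startingPoint (α := 1 / 2) (by norm_num) (i / 4) r I hn
    (i / 4 + j / (2 * p)) (by
      rcases hr with hr | rfl
      · exact Or.inl hr
      · refine Or.inr ⟨j, by simpa using hjp', ?_⟩
        simp only [ENat.toNat_natCast]
        field_simp)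
  have hstart : ∀ e, I.start e ∈ (endpoints I).val := fun e =>
    (mem_endpoints I _).2 ⟨e, Or.inl rfl⟩
  have hend : ∀ e, I.start e + I.len e ∈ (endpoints I).val := fun e =>
    (mem_endpoints I _).2 ⟨e, Or.inr rfl⟩
  -- The tried starting point matches the grid point only up to `m` whole periods, so period numbers
  -- shift by `m`.
  refine ⟨τ + m * (1 / 2), fun e => ?_, fun Q hQ hQt => ?_⟩
  · obtain ⟨z, a1, a2, a3, a4⟩ := hW τ hτ e
    have b1 := hm _ (hstart e) (z - m - 1)
    have b2 := hm _ (hstart e) (z - m)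
    have b3 := hm _ (hend e) (z - m + 3)
    push_cast at *
    refine ⟨z - m, ⟨?_, ?_, ?_, ?_⟩, ?_, ?_, ?_⟩
    · push_cast; linarith
    · push_cast; linarith
    · push_cast; linarith
    · push_cast; linarith
    · push_cast
      by_contra hc
      have := b1.1 (not_lt.1 hc)
      linarith
    · push_cast
      exact b2.2 (by linarith)
    · push_cast
      exact b3.2 (by linarith)
  · have h1 : (trim I (1 / 2) τ (scheme3 1 1)).val.IsRun s Q := by
      refine ⟨hQ, fun e he => ?_⟩
      obtain ⟨z, ⟨a1, a2, a3, a4⟩, ht⟩ := hQt e he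
      refine ⟨z + m, trimWindow_of_fillsTwo ⟨?_, ?_, ?_, ?_⟩, ?_, ?_⟩
      · push_cast; linarith
      · push_cast; linarith
      · push_cast; linarith
      · push_cast; linarith
      · have := ht.1
        simp only [trim, Timed.bind_val, Timed.pure_val]
        push_cast; linarith
      · have := ht.2
        simp only [trim, Timed.bind_val, Timed.pure_val]
        push_cast; linarith
    refine (profit_le_speedup halg hI hγ hs (by norm_num) r (i / 4) _ hτ h1).trans ?_
    refine mul_le_mul_of_nonneg_left ?_ hγ
    exact_mod_cast (le_profit_retainBest (fun call : Call =>
      speedup alg s r I call.α call.b call.c) (phase1 ++ phase2 ++ phase3) (Run.empty n)).2 _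
      (List.mem_append_left _ (List.mem_append_left _ (mem_phase1 hi)))

theorem profit_le_speedupW12 {s : ℝ} (hγ : 0 ≤ γ) (hs2 : 2 ≤ s) (hs5 : s ≤ 5 / 2) {r : ℕ∞}
    (hr : r = ⊤ ∨ ∃ q p : ℕ, 0 < p ∧ r = p ∧ s = (q : ℝ) / p) (hn : 0 < n) {i : ℕ} (hi : i < 2)
    (hW : ∀ τ ∈ (startingPoints (1 / 2) (i / 4) r I).val,
        ∀ e, InW 2 (1 / 2) τ (I.start e) (I.len e))
    {R : Run n} (hR : I.IsRun 1 R) :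
    (R.profit : ℝ) ≤ 8 * γ / (2 * s - 1) * (speedupW12 alg s r I).val.profit := by
  have hs : 0 < s := by linarith
  set P : ℝ := ((speedupW12 alg s r I).val.profit : ℝ)
  suffices h : (2 * s - 1) * (R.profit : ℝ) ≤ 8 * (γ * P) by
    rw [div_mul_eq_mul_div, le_div_iff₀ (by linarith)]
    linarith
  have ratio : ∀ p q : ℕ, 0 < p → (2 : ℝ) ≤ q / p → (q : ℝ) / p ≤ s → r = ⊤ ∨ r = p →
      (2 * ((q : ℝ) / p) - 1) * (R.profit : ℝ) ≤ 8 * (γ * P) := by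
    intro p q hp h2 hqs hr
    have hp' : (0 : ℝ) < p := by exact_mod_cast hp
    have h5 := hqs.trans hs5
    rw [le_div_iff₀ hp'] at h2
    rw [div_le_iff₀ hp'] at h5
    have h5' : 2 * (q : ℝ) ≤ 5 * p := by linarith
    have := profit_le_of_ratio halg hI hγ hs hn hi hW hR hp (by exact_mod_cast h2)
      (by exact_mod_cast h5') hqs hr
    have e : (2 * ((q : ℝ) / p) - 1) * (R.profit : ℝ) =
        ((4 * q - 2 * p) * (R.profit : ℝ)) / (2 * p) := by
      field_simp; ring
    rw [e, div_le_iff₀ (by positivity)]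
    linarith
  rcases hr with hr | ⟨q, p, hp, hr, rfl⟩
  · rcases hs2.eq_or_lt with rfl | hlt
    -- At `s = 2` no ratio below `s` is admissible, so 2/1 itself is used.
    · simpa using ratio 1 2 one_pos (by norm_num) (by norm_num) (Or.inl hr)
    · refine le_of_forall_lt_imp_le_of_dense fun a ha => ?_
      have hcont : Filter.Tendsto (fun x : ℝ => (2 * x - 1) * (R.profit : ℝ))
          (nhdsWithin s (Set.Iio s)) (nhds ((2 * s - 1) * R.profit)) :=
        (Continuous.tendsto (by fun_prop) s).mono_left nhdsWithin_le_nhds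
      obtain ⟨u, hu, hu'⟩ := (mem_nhdsLT_iff_exists_Ioo_subset' hlt).1
        (hcont.eventually (lt_mem_nhds ha))
      -- A rational speed between 2 and `s`, so close to `s` that the left side still exceeds `a`.
      obtain ⟨x, hx1, hx2⟩ := exists_rat_btwn (max_lt hu hlt)
      have hx3 : (2 : ℝ) < x := (le_max_right _ _).trans_lt hx1
      have hx0 : 0 ≤ x := by
        have : (0 : ℝ) ≤ x := by linarith
        exact_mod_cast this
      have hx : ((x.num.toNat : ℕ) : ℝ) / (x.den : ℕ) = x := by
        have h1 : ((x.num.toNat : ℕ) : ℝ) = ((x.num : ℤ) : ℝ) := by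
          exact_mod_cast Int.toNat_of_nonneg (Rat.num_nonneg.2 hx0)
        rw [h1]
        exact (Rat.cast_def x).symm
      have h1 := ratio x.den x.num.toNat x.den_pos (by rw [hx]; exact hx3.le)
        (by rw [hx]; exact hx2.le) (Or.inl hr)
      rw [hx] at h1
      exact (hu' ⟨(le_max_left _ _).trans_lt hx1, hx2⟩).le.trans h1
  · exact ratio p q hp hs2 le_rfl (Or.inr hr)

end SpeedupW12

end Repairman

theorem mainTheorem4 :
    ∃ C : ℕ, ∀ (𝒢 : Repairman.GraphClass) (γ : ℝ) (Γ : ℕ → ℕ) (alg : Repairman.TrimmedAlg),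
      1 ≤ γ → (∀ n, n ≤ Γ n) → Repairman.IsTrimmedApprox 𝒢 γ Γ alg →
      ∀ (s : ℝ) (r : ℕ∞), 2 ≤ s → s ≤ 5 / 2 →
      (r = ⊤ ∨ ∃ q p : ℕ, 0 < p ∧ r = p ∧ s = (q : ℝ) / p) →
      ∀ (N n : ℕ) (I : Repairman.Instance N n), 0 < n → 𝒢 N I.graph →
      ∀ i : ℕ, i < 2 →
      (∀ τ ∈ (Repairman.startingPoints (1 / 2) (i / 4) r I).val,
        ∀ e, Repairman.InW 2 (1 / 2) τ (I.start e) (I.len e)) →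
      I.IsRun s (Repairman.speedupW12 alg s r I).val ∧
      (∀ R : Repairman.Run n, I.IsRun 1 R →
        (R.profit : ℝ) ≤
          8 * γ / (2 * s - 1) * (Repairman.speedupW12 alg s r I).val.profit) ∧
      ((Repairman.speedupW12 alg s r I).steps : ℕ∞) ≤
        C * min r (Repairman.numPeriodSets I) * Γ (N + n) := by
  refine ⟨3000, fun 𝒢 γ Γ alg hγ hΓ halg s r hs2 hs5 hr N n I hn hI i hi hW => ?_⟩
  have hs : 0 < s := by linarith
  have hr0 : r ≠ 0 := by
    rcases hr with rfl | ⟨q, p, hp, rfl, -⟩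
    · simp
    · exact_mod_cast hp.ne'
  exact ⟨Repairman.speedupW12_isRun halg hI hs r,
    fun R hR => Repairman.profit_le_speedupW12 halg hI (by linarith) hs2 hs5 hr hn hi hW hR,
    Repairman.speedupW12_steps_le halg hI hs hr0 hn (hΓ _)⟩
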